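/- Let $0<s<1$. For $d\in\mathbb{N}=\{1,2,\dots\}$ let $W^s([0,1]^d)$ be the space of all real-valued functions $f\in L_2([0,1]^d)$, given by their Fourier series $f(x)=\sum_{m\in\mathbb{Z}^d}a_m e^{2\pi i\, m\cdot x}$ (convergent in $L_2([0,1]^d)$), for which $$\|f\|_{W^s}^2:=|a_0|^2+\sum_{m\in\mathbb{Z}^d\setminus\{0\}}\|m\|_2^{2s}\,|a_m|^2<\infty .$$ For positive integers $d,W,L$ let $\Upsilon_d^{W,L}$ be the set of all functions $\mathcal N:\mathbb{R}^d\to\mathbb{R}$ of the form $$\mathcal N=A^{(L)}\circ\mathrm{ReLU}\circ A^{(L-1)}\circ\cdots\circ\mathrm{ReLU}\circ A^{(0)},$$ where $A^{(0)}:\mathbb{R}^d\to\mathbb{R}^W$, $A^{(j)}:\mathbb{R}^W\to\mathbb{R}^W$ ($1\le j\le L-1$) and $A^{(L)}:\mathbb{R}^W\to\mathbb{R}$ are affine and $\mathrm{ReLU}(t)=\max\{t,0\}$ acts coordinatewise. There are constants $c_3,c_4,c_5>0$, depending only on $s$, such that for all $d\in\mathbb{N}$, all $0<\varepsilon<1$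 and all positive integers $W,L$ the following holds. If either $$\varepsilon\ge c_3\,d^{-s/2},\qquad W\ge\bigl(c_4\,\varepsilon^{2/s}\,d\bigr)^{c_5\,\varepsilon^{-2/s}}\qquad\text{and}\qquad L\ge c_4\log_2(1/\varepsilon),$$ or $$\varepsilon\le c_3\,d^{-s/2},\qquad W\ge\Bigl(\frac{c_4}{\varepsilon^{1/s}\sqrt d}\Bigr)^{d}\qquad\text{and}\qquad L\ge c_4\log_2(1/\varepsilon),$$ then for every $f\in W^s([0,1]^d)$ $$\inf_{\mathcal N\in\Upsilon_d^{W,L}}\|f-\mathcal N\|_{L_2([0,1]^d)}\le\varepsilon\,\|f\|_{W^s}.$$ -/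

import Mathlib

open MeasureTheory Filter Topology

noncomputable section

/-- Lebesgue measure on the unit cube `[0,1]^d`. -/
def cubeMeasure (d : ℕ) : Measure (Fin d → ℝ) :=
  volume.restrict (Set.Icc 0 1)

/-- The exponential `x ↦ exp (2 π i m · x)` with frequency `m ∈ ℤ^d`. -/
def fourierExp {d : ℕ} (m : Fin d → ℤ) (x : Fin d → ℝ) : ℂ :=
  Complex.exp (2 * Real.pi * Complex.I * ((∑ i, (m i : ℝ) * x i : ℝ) : ℂ))

/-- The Fourier coefficient `a_m = ∫_{[0,1]^d} f(x) exp (-2 π i m · x) dx` of a real-valued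
function. -/
def cubeFourierCoeff {d : ℕ} (f : (Fin d → ℝ) → ℝ) (m : Fin d → ℤ) : ℂ :=
  ∫ x, (f x : ℂ) * fourierExp (-m) x ∂(cubeMeasure d)

/-- The Euclidean norm of an integer vector. -/
def freqNorm {d : ℕ} (m : Fin d → ℤ) : ℝ :=
  Real.sqrt (∑ i, (m i : ℝ) ^ 2)

/-- `f ∈ W^s([0,1]^d)` for a real-valued `f`: the function `f` is square integrable over the cube,
it is given by its Fourier series (convergence in `L_2([0,1]^d)` of the net of finite partial
sums), and `∑_{m ≠ 0} ‖m‖_2^{2s} |a_m|² < ∞`. Only the values of `f` on the cube matter. -/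
structure MemSobolev {d : ℕ} (s : ℝ) (f : (Fin d → ℝ) → ℝ) : Prop where
  memLp : MemLp f 2 (cubeMeasure d)
  fourier : Tendsto
    (fun F : Finset (Fin d → ℤ) =>
      eLpNorm (fun x => (f x : ℂ) - ∑ m ∈ F, cubeFourierCoeff f m * fourierExp m x) 2
        (cubeMeasure d))
    atTop (𝓝 0)
  summable : Summable fun m : {m : Fin d → ℤ // m ≠ 0} =>
    freqNorm m.1 ^ (2 * s) * ‖cubeFourierCoeff f m.1‖ ^ 2

/-- `‖f‖_{W^s} = (|a_0|² + ∑_{m ≠ 0} ‖m‖_2^{2s} |a_m|²)^{1/2}`. -/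
def sobolevNorm {d : ℕ} (s : ℝ) (f : (Fin d → ℝ) → ℝ) : ℝ :=
  Real.sqrt (‖cubeFourierCoeff f 0‖ ^ 2 +
    ∑' m : {m : Fin d → ℤ // m ≠ 0}, freqNorm m.1 ^ (2 * s) * ‖cubeFourierCoeff f m.1‖ ^ 2)

/-- The ReLU activation, applied to every coordinate. -/
def reluVec {W : ℕ} (y : Fin W → ℝ) : Fin W → ℝ := fun i => max (y i) 0

/-- A feed-forward ReLU network with input dimension `d`, width `W` and depth `L` (all positive):
a collection of `L + 1` affine mappings `A⁽⁰⁾ : ℝ^d → ℝ^W`, `A⁽ʲ⁾ : ℝ^W → ℝ^W` for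
`j = 1, …, L - 1` and `A⁽ᴸ⁾ : ℝ^W → ℝ`. -/
structure ReLUNetwork (d W L : ℕ) where
  input : (Fin d → ℝ) →ᵃ[ℝ] (Fin W → ℝ)
  hidden : Fin (L - 1) → ((Fin W → ℝ) →ᵃ[ℝ] (Fin W → ℝ))
  output : (Fin W → ℝ) →ᵃ[ℝ] ℝ

/-- The function `A⁽ᴸ⁾ ∘ ReLU ∘ A⁽ᴸ⁻¹⁾ ∘ ⋯ ∘ ReLU ∘ A⁽⁰⁾` generated by a network. -/
def ReLUNetwork.eval {d W L : ℕ} (N : ReLUNetwork d W L) (x : Fin d → ℝ) : ℝ :=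
  N.output ((List.ofFn N.hidden).foldl (fun y A => reluVec (A y)) (reluVec (N.input x)))

end

noncomputable section

/-! ### Exponentials in `L₂` of the cube -/

/-! Write `σ(k) = χ₄(k) k` and `w(k) = |χ₄(k)| / k²`. The complex wave `T(t) = ∑ w(k) exp (2πi σ(k)
t)` has as real and imaginary parts affine images of one piecewise linear triangle wave and of its
translate by `3/4`, so ReLU networks reproduce both parts of `T(n · x)` exactly on the cube. Both
`w` and `σ` are completely multiplicative and `w` is summable, so Möbius inversion gives `exp (2πi
t) = ∑ μ(k) w(k) T(σ(k) t)` (`hasSum_moebius_inversion`).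

Substitute this into the Fourier series of `f`, keeping the constant term and the pairs `(m, k)`
with `m ≠ 0` and `k ‖m‖ ≤ R`; all waves then have frequency in the ball of radius `R`. For fixed `k`
the discarded part is a combination of the `T(σ(k) m · x)` with `‖m‖ > R / k`. Dilation keeps
exponentials orthonormal, so its norm is at most `∑ w` times the `ℓ₂` norm of its coefficients
(`norm_sum_triangle_le`), and smoothness makes the latter at most `(R / k)^(-s) ‖f‖`. Summing over
`k` yields an error `D R^(-s) ‖f‖`, with `D` independent of `d` (`exists_triangle_sum_approx`); `R`
is taken proportional to `ε^(-1/s)`.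

The lattice points of the ball are counted through the generating function `∑ q^(‖m‖₁)`, a product
over coordinates (`card_mul_rpow_le`). For small `ε`, waves come from iterated tent maps, with two
neurons per layer each and logarithmic depth. For `ε` close to `1` no depth is guaranteed, so each
wave is built in one hidden layer with `O(R²)` neurons, which the width absorbs. -/

instance cubeMeasure_isProbabilityMeasure (d : ℕ) : IsProbabilityMeasure (cubeMeasure d) := by
  constructor
  rw [cubeMeasure, Measure.restrict_apply_univ, Real.volume_Icc_pi]
  simp

lemma cubeMeasure_eq_pi (d : ℕ) :
    cubeMeasure d = Measure.pi fun _ : Fin d => (volume.restrict (Set.Icc (0 : ℝ) 1)) := by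
  rw [cubeMeasure, ← Set.pi_univ_Icc, volume_pi, Measure.restrict_pi_pi]
  rfl

lemma continuous_fourierExp {d : ℕ} (m : Fin d → ℤ) : Continuous (fourierExp m) := by
  unfold fourierExp
  fun_prop

lemma norm_fourierExp {d : ℕ} (m : Fin d → ℤ) (x : Fin d → ℝ) : ‖fourierExp m x‖ = 1 := by
  rw [fourierExp, show (2 * Real.pi * Complex.I * ((∑ i, (m i : ℝ) * x i : ℝ) : ℂ)) =
    ((2 * Real.pi * (∑ i, (m i : ℝ) * x i) : ℝ) : ℂ) * Complex.I by push_cast; ring]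
  exact Complex.norm_exp_ofReal_mul_I _

lemma fourierExp_zero {d : ℕ} (x : Fin d → ℝ) : fourierExp 0 x = 1 := by
  simp [fourierExp]

lemma fourierExp_eq_prod {d : ℕ} (m : Fin d → ℤ) (x : Fin d → ℝ) :
    fourierExp m x = ∏ i, Complex.exp (2 * Real.pi * Complex.I * (m i) * (x i)) := by
  rw [fourierExp, ← Complex.exp_sum]
  congr 1
  push_cast
  rw [Finset.mul_sum]
  exact Finset.sum_congr rfl fun i _ => by ring

lemma conj_fourierExp_mul {d : ℕ} (m n : Fin d → ℤ) (x : Fin d → ℝ) :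
    (starRingEnd ℂ) (fourierExp m x) * fourierExp n x = fourierExp (n - m) x := by
  rw [fourierExp, fourierExp, fourierExp, ← Complex.exp_conj, ← Complex.exp_add]
  congr 1
  simp only [map_mul, Complex.conj_ofReal, Complex.conj_I, Pi.sub_apply, map_ofNat]
  rw [mul_neg, neg_mul, ← sub_eq_neg_add, ← mul_sub]
  congr 1
  push_cast
  rw [← Finset.sum_sub_distrib]
  exact Finset.sum_congr rfl fun i _ => by ring

lemma integral_Icc_exp (k : ℤ) (hk : k ≠ 0) :
    ∫ x in Set.Icc (0 : ℝ) 1, Complex.exp (2 * Real.pi * Complex.I * k * x) = 0 := by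
  rw [integral_Icc_eq_integral_Ioc, ← intervalIntegral.integral_of_le zero_le_one]
  have hc : (2 * Real.pi * Complex.I * k : ℂ) ≠ 0 := by
    simp [Real.pi_ne_zero, hk]
  rw [integral_exp_mul_complex hc]
  have : Complex.exp (2 * Real.pi * Complex.I * k * (1 : ℝ)) = 1 := by
    rw [show (2 * Real.pi * Complex.I * k * (1 : ℝ) : ℂ) = k * (2 * Real.pi * Complex.I) by
      push_cast; ring]
    exact Complex.exp_int_mul_two_pi_mul_I k
  rw [this]
  simp

lemma integral_fourierExp {d : ℕ} (m : Fin d → ℤ) :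
    ∫ x, fourierExp m x ∂(cubeMeasure d) = if m = 0 then 1 else 0 := by
  split_ifs with h
  · subst h
    simp [fourierExp_zero]
  · obtain ⟨i, hi⟩ := Function.ne_iff.mp h
    simp only [fourierExp_eq_prod, cubeMeasure_eq_pi]
    rw [integral_fintype_prod_eq_prod
      (f := fun i y => Complex.exp (2 * Real.pi * Complex.I * (m i) * ((y : ℝ) : ℂ)))]
    exact Finset.prod_eq_zero (Finset.mem_univ i) (integral_Icc_exp _ hi)

lemma memLp_of_continuous_bounded {d : ℕ} {g : (Fin d → ℝ) → ℂ} (hg : Continuous g) (C : ℝ)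
    (hC : ∀ x, ‖g x‖ ≤ C) : MemLp g 2 (cubeMeasure d) :=
  MemLp.of_bound hg.aestronglyMeasurable C (Eventually.of_forall hC)

lemma memLp_fourierExp {d : ℕ} (m : Fin d → ℤ) : MemLp (fourierExp m) 2 (cubeMeasure d) :=
  memLp_of_continuous_bounded (continuous_fourierExp m) 1 fun x => (norm_fourierExp m x).le

/-- The exponential with frequency `m` as an element of `L₂`. -/
def expLp {d : ℕ} (m : Fin d → ℤ) : Lp ℂ 2 (cubeMeasure d) := (memLp_fourierExp m).toLp

lemma orthonormal_expLp (d : ℕ) : Orthonormal ℂ (expLp (d := d)) := by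
  classical
  rw [orthonormal_iff_ite]
  intro m n
  rw [L2.inner_def]
  have h : ∫ x, inner ℂ (expLp m x) (expLp n x) ∂(cubeMeasure d) =
      ∫ x, fourierExp (n - m) x ∂(cubeMeasure d) := by
    refine integral_congr_ae ?_
    filter_upwards [(memLp_fourierExp m).coeFn_toLp, (memLp_fourierExp n).coeFn_toLp] with x h1 h2
    rw [expLp, expLp, h1, h2, RCLike.inner_apply', conj_fourierExp_mul]
  rw [h, integral_fourierExp]
  simp [sub_eq_zero, eq_comm]

lemma coeFn_sum_smul_toLp {α ι : Type*} [MeasurableSpace α] {μ : Measure α} {g : ι → α → ℂ}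
    (hg : ∀ i, MemLp (g i) 2 μ) (a : ι → ℂ) (F : Finset ι) :
    ((∑ i ∈ F, a i • (hg i).toLp : Lp ℂ 2 μ) : α → ℂ) =ᵐ[μ] fun x => ∑ i ∈ F, a i * g i x := by
  classical
  induction F using Finset.induction_on with
  | empty =>
    simp only [Finset.sum_empty]
    exact Lp.coeFn_zero _ _ _
  | insert j F hj ih =>
    simp only [Finset.sum_insert hj]
    filter_upwards [Lp.coeFn_add (a j • (hg j).toLp) (∑ i ∈ F, a i • (hg i).toLp),
      Lp.coeFn_smul (a j) (hg j).toLp, (hg j).coeFn_toLp, ih] with x h1 h2 h3 h4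
    rw [h1, Pi.add_apply, h2, Pi.smul_apply, h3, h4, smul_eq_mul]

lemma hasSum_smul_toLp {α ι : Type*} [MeasurableSpace α] {μ : Measure α} {f : α → ℂ}
    (hf : MemLp f 2 μ) {g : ι → α → ℂ} (hg : ∀ i, MemLp (g i) 2 μ) (a : ι → ℂ)
    (h : Tendsto (fun F : Finset ι => eLpNorm (fun x => f x - ∑ i ∈ F, a i * g i x) 2 μ)
      atTop (𝓝 0)) :
    HasSum (fun i => a i • (hg i).toLp) hf.toLp := by
  rw [HasSum, SummationFilter.unconditional_filter, Lp.tendsto_Lp_iff_tendsto_eLpNorm]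
  refine h.congr fun F => ?_
  rw [← eLpNorm_neg]
  refine eLpNorm_congr_ae ?_
  filter_upwards [coeFn_sum_smul_toLp hg a F] with x h1
  simp only [Pi.neg_apply, Pi.sub_apply, neg_sub]
  rw [h1]

/-! ### The multiplicative structure of the triangle-wave system -/

/-- The weights `1 / k²` supported on odd `k`. -/
def oddWeight (k : ℕ) : ℝ := |((ZMod.χ₄ (k : ZMod 4) : ℤ) : ℝ)| / (k : ℝ) ^ 2

/-- The completely multiplicative map `k ↦ χ₄(k) k`. -/
def signedOdd (k : ℕ) : ℤ := ZMod.χ₄ (k : ZMod 4) * k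

lemma oddWeight_nonneg (k : ℕ) : 0 ≤ oddWeight k := by unfold oddWeight; positivity

lemma oddWeight_zero : oddWeight 0 = 0 := by simp [oddWeight]

lemma oddWeight_one : oddWeight 1 = 1 := by simp [oddWeight]

lemma oddWeight_mul (j k : ℕ) : oddWeight (j * k) = oddWeight j * oddWeight k := by
  simp only [oddWeight, Nat.cast_mul, map_mul, Int.cast_mul, abs_mul]
  rw [mul_pow, mul_div_mul_comm]

lemma signedOdd_one : signedOdd 1 = 1 := by simp [signedOdd]

lemma signedOdd_mul (j k : ℕ) : signedOdd (j * k) = signedOdd j * signedOdd k := by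
  simp only [signedOdd, Nat.cast_mul, map_mul]
  ring

lemma abs_chi_le_one (k : ℕ) : |((ZMod.χ₄ (k : ZMod 4) : ℤ) : ℝ)| ≤ 1 := by
  rw [ZMod.χ₄_nat_eq_if_mod_four]
  split_ifs <;> simp

lemma oddWeight_le (k : ℕ) : oddWeight k ≤ 1 / (k : ℝ) ^ 2 :=
  div_le_div_of_nonneg_right (abs_chi_le_one k) (by positivity)

lemma summable_oddWeight : Summable oddWeight :=
  Summable.of_nonneg_of_le oddWeight_nonneg oddWeight_le
    (Real.summable_one_div_nat_pow.mpr one_lt_two)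

/-- The terms are at most `k ^ (s - 2)`. This series is where the restriction `s < 1` enters. -/
lemma summable_oddWeight_mul_rpow {s : ℝ} (hs : s < 1) :
    Summable fun k : ℕ => oddWeight k * (k : ℝ) ^ s := by
  refine Summable.of_nonneg_of_le
    (fun k => mul_nonneg (oddWeight_nonneg k) (by positivity)) (fun k => ?_)
    (Real.summable_nat_rpow.mpr (show s - 2 < -1 by linarith))
  rcases Nat.eq_zero_or_pos k with rfl | hk
  · simp only [oddWeight_zero, zero_mul]
    positivity
  · have hk' : (0 : ℝ) < k := by exact_mod_cast hk
    rw [Real.rpow_sub hk', div_eq_mul_one_div, mul_comm]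
    gcongr
    simpa using oddWeight_le k

lemma signedOdd_ne_zero {k : ℕ} (hk : oddWeight k ≠ 0) : signedOdd k ≠ 0 := by
  intro h
  apply hk
  rcases mul_eq_zero.mp h with h | h
  · simp only [oddWeight, h, Int.cast_zero, abs_zero, zero_div]
  · have h' : k = 0 := by exact_mod_cast h
    simp [h', oddWeight_zero]

open ArithmeticFunction in
lemma norm_moebius_mul_le (k : ℕ) :
    ‖((moebius k : ℤ) : ℂ) * (oddWeight k : ℂ)‖ ≤ oddWeight k := by
  rw [norm_mul, Complex.norm_real, Real.norm_of_nonneg (oddWeight_nonneg k)]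
  have h : ‖((moebius k : ℤ) : ℂ)‖ ≤ 1 := by
    rw [Complex.norm_intCast]
    exact_mod_cast abs_moebius_le_one
  exact mul_le_of_le_one_left (oddWeight_nonneg k) h

open ArithmeticFunction in
/-- Möbius inversion: the exponential is recovered from the dilated triangle waves. -/
lemma hasSum_moebius_inversion {H : Type*} [NormedAddCommGroup H] [NormedSpace ℂ H]
    [CompleteSpace H] (E T : ℤ → H) (hE : ∀ l, ‖E l‖ ≤ 1)
    (hT : ∀ l, HasSum (fun k => (oddWeight k : ℂ) • E (signedOdd k * l)) (T l)) :
    HasSum (fun k => (((moebius k : ℤ) : ℂ) * (oddWeight k : ℂ)) • T (signedOdd k)) (E 1) := by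
  classical
  set F : ℕ × ℕ → H := fun p =>
    (((moebius p.1 : ℤ) : ℂ) * (oddWeight p.1 : ℂ) * (oddWeight p.2 : ℂ)) •
      E (signedOdd (p.1 * p.2)) with hF
  have hFs : Summable F := by
    refine Summable.of_norm_bounded
      (summable_oddWeight.mul_of_nonneg summable_oddWeight oddWeight_nonneg oddWeight_nonneg) ?_
    rintro ⟨k, j⟩
    simp only [hF]
    rw [norm_smul, norm_mul, Complex.norm_real, Real.norm_of_nonneg (oddWeight_nonneg j)]
    refine (mul_le_of_le_one_right (mul_nonneg (norm_nonneg _) (oddWeight_nonneg _))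
      (hE _)).trans ?_
    exact mul_le_mul_of_nonneg_right (norm_moebius_mul_le k) (oddWeight_nonneg _)
  have hrow : ∀ k, HasSum (fun j => F (k, j))
      ((((moebius k : ℤ) : ℂ) * (oddWeight k : ℂ)) • T (signedOdd k)) := by
    intro k
    convert (hT (signedOdd k)).const_smul (((moebius k : ℤ) : ℂ) * (oddWeight k : ℂ)) using 2
      with j
    simp only [hF]
    rw [smul_smul, signedOdd_mul, mul_comm (signedOdd k)]
  have h1 := hFs.hasSum.prod_fiberwise hrow
  -- Grouped by `N = k * j ≥ 1`, the family contributes `oddWeight N • E (signedOdd N)` times the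
  -- divisor sum of `μ`, which vanishes unless `N = 1`.
  have h2 := hFs.hasSum.tsum_fiberwise (fun p : ℕ × ℕ => p.1 * p.2)
  have h3 : ∀ N : ℕ, ∑' x : (fun p : ℕ × ℕ => p.1 * p.2) ⁻¹' {N}, F x =
      if N = 1 then E 1 else 0 := by
    intro N
    rw [tsum_subtype, tsum_eq_sum (s := N.divisorsAntidiagonal)]
    · have h4 : ∀ x ∈ N.divisorsAntidiagonal,
          ((fun p : ℕ × ℕ => p.1 * p.2) ⁻¹' {N}).indicator F x =
            (((moebius x.1 : ℤ) : ℂ)) • ((oddWeight N : ℂ) • E (signedOdd N)) := by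
        rintro ⟨k, j⟩ hx
        have hN : k * j = N := (Nat.mem_divisorsAntidiagonal.mp hx).1
        rw [Set.indicator_of_mem (by simpa using hN)]
        simp only [hF]
        rw [smul_smul, ← hN, oddWeight_mul]
        push_cast
        ring_nf
      rw [Finset.sum_congr rfl h4, ← Finset.sum_smul,
        Nat.sum_divisorsAntidiagonal (fun x _ => ((moebius x : ℤ) : ℂ)), ← Int.cast_sum,
        ← coe_mul_zeta_apply, moebius_mul_coe_zeta, one_apply]
      by_cases h : N = 1
      · simp [h, oddWeight_one, signedOdd_one]
      · simp [h]
    · rintro ⟨k, j⟩ hx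
      by_cases hN : k * j = N
      · have hN0 : k * j = 0 := by
          by_contra h
          exact hx (Nat.mem_divisorsAntidiagonal.mpr ⟨hN, hN ▸ h⟩)
        rw [Set.indicator_of_mem (by simpa using hN)]
        rcases Nat.mul_eq_zero.mp hN0 with h | h <;> simp [hF, h, oddWeight_zero]
      · exact Set.indicator_of_notMem (by simpa using hN) _
  simp only [h3] at h2
  have h5 := (hasSum_ite_eq 1 (E 1)).unique h2
  rwa [← h5] at h1

/-! ### Approximation in Hilbert space -/

section Hilbert

variable {H : Type*} [NormedAddCommGroup H] [InnerProductSpace ℂ H]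

lemma norm_sum_smul_orthonormal {ι : Type*} {e : ι → H} (he : Orthonormal ℂ e) (a : ι → ℂ)
    (F : Finset ι) : ‖∑ i ∈ F, a i • e i‖ = Real.sqrt (∑ i ∈ F, ‖a i‖ ^ 2) := by
  rw [eq_comm, Real.sqrt_eq_iff_mul_self_eq (by positivity) (norm_nonneg _), ← pow_two]
  have h := he.inner_sum a a F
  have h2 := inner_self_eq_norm_sq_to_K (𝕜 := ℂ) (∑ i ∈ F, a i • e i)
  rw [h] at h2
  have h3 : ((∑ i ∈ F, ‖a i‖ ^ 2 : ℝ) : ℂ) = ((‖∑ i ∈ F, a i • e i‖ ^ 2 : ℝ) : ℂ) := by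
    push_cast
    refine Eq.trans (Finset.sum_congr rfl fun i _ => ?_) h2
    rw [← Complex.conj_mul']
  exact_mod_cast h3

lemma freqNorm_nonneg {d : ℕ} (m : Fin d → ℤ) : 0 ≤ freqNorm m := Real.sqrt_nonneg _

lemma freqNorm_zsmul {d : ℕ} (c : ℤ) (m : Fin d → ℤ) :
    freqNorm (c • m) = |(c : ℝ)| * freqNorm m := by
  unfold freqNorm
  rw [← Real.sqrt_sq_eq_abs, ← Real.sqrt_mul (sq_nonneg _), Finset.mul_sum]
  congr 1
  exact Finset.sum_congr rfl fun i _ => by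
    simp only [Pi.smul_apply, smul_eq_mul, Int.cast_mul]
    ring

lemma one_le_freqNorm {d : ℕ} {m : Fin d → ℤ} (hm : m ≠ 0) : 1 ≤ freqNorm m := by
  obtain ⟨i, hi⟩ := Function.ne_iff.mp hm
  refine Real.one_le_sqrt.mpr ?_
  have h1 : (1 : ℝ) ≤ (m i : ℝ) ^ 2 := by
    have h : (1 : ℤ) ≤ m i ^ 2 := by
      have := sq_pos_of_ne_zero (show m i ≠ 0 from hi)
      lia
    exact_mod_cast h
  exact h1.trans (Finset.single_le_sum (f := fun i => (m i : ℝ) ^ 2)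
    (fun i _ => sq_nonneg _) (Finset.mem_univ i))

lemma abs_signedOdd_le (k : ℕ) : |(signedOdd k : ℝ)| ≤ k := by
  rw [signedOdd, Int.cast_mul, abs_mul]
  refine (mul_le_of_le_one_left (abs_nonneg _) (abs_chi_le_one k)).trans ?_
  simp

lemma sqrt_sum_sq_le_rpow {d : ℕ} {s : ℝ} (hs : 0 < s) {a : (Fin d → ℤ) → ℂ}
    (ha : Summable fun m : {m : Fin d → ℤ // m ≠ 0} => freqNorm m.1 ^ (2 * s) * ‖a m.1‖ ^ 2)
    {ρ : ℝ} (hρ : 0 < ρ) (G : Finset (Fin d → ℤ)) (hG0 : ∀ m ∈ G, m ≠ 0)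
    (hG : ∀ m ∈ G, ρ ≤ freqNorm m) :
    Real.sqrt (∑ m ∈ G, ‖a m‖ ^ 2) ≤ ρ ^ (-s) * Real.sqrt (‖a 0‖ ^ 2 +
      ∑' m : {m : Fin d → ℤ // m ≠ 0}, freqNorm m.1 ^ (2 * s) * ‖a m.1‖ ^ 2) := by
  refine Real.sqrt_le_iff.mpr ⟨by positivity, ?_⟩
  have hpos : ∀ m : {m : Fin d → ℤ // m ≠ 0}, 0 ≤ freqNorm m.1 ^ (2 * s) * ‖a m.1‖ ^ 2 :=
    fun m => mul_nonneg (Real.rpow_nonneg (freqNorm_nonneg _) _) (sq_nonneg _)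
  rw [mul_pow, Real.sq_sqrt (add_nonneg (sq_nonneg _) (tsum_nonneg hpos)),
    ← Real.rpow_mul_natCast hρ.le]
  have h1 : ∑ m ∈ G, freqNorm m ^ (2 * s) * ‖a m‖ ^ 2 ≤ ‖a 0‖ ^ 2 +
      ∑' m : {m : Fin d → ℤ // m ≠ 0}, freqNorm m.1 ^ (2 * s) * ‖a m.1‖ ^ 2 := by
    rw [← Finset.sum_subtype_of_mem (fun m => freqNorm m ^ (2 * s) * ‖a m‖ ^ 2) hG0]
    exact (ha.sum_le_tsum _ fun m _ => hpos m).trans (le_add_of_nonneg_left (sq_nonneg _))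
  refine le_trans ?_ (mul_le_mul_of_nonneg_left h1 (by positivity))
  rw [Finset.mul_sum]
  refine Finset.sum_le_sum fun m hm => ?_
  rw [← mul_assoc]
  refine le_mul_of_one_le_left (sq_nonneg _) ?_
  rw [show -s * ((2 : ℕ) : ℝ) = -(2 * s) by push_cast; ring, Real.rpow_neg hρ.le,
    ← div_eq_inv_mul, one_le_div (by positivity)]
  exact Real.rpow_le_rpow hρ.le (hG m hm) (by positivity)

/-- For finite `G ⊇ F` the difference of partial sums involves only frequencies above `R`, so the
finite tail bound applies; then `G` tends to everything. -/
lemma norm_sub_sum_le_rpow {d : ℕ} {e : (Fin d → ℤ) → H} (he : Orthonormal ℂ e) {s : ℝ}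
    (hs : 0 < s) {a : (Fin d → ℤ) → ℂ} {f : H} (hf : HasSum (fun m => a m • e m) f)
    (ha : Summable fun m : {m : Fin d → ℤ // m ≠ 0} => freqNorm m.1 ^ (2 * s) * ‖a m.1‖ ^ 2)
    {R : ℝ} (hR : 0 < R) (F : Finset (Fin d → ℤ)) (hF : ∀ m, m ∈ F ↔ freqNorm m ≤ R) :
    ‖f - ∑ m ∈ F, a m • e m‖ ≤ R ^ (-s) * Real.sqrt (‖a 0‖ ^ 2 +
      ∑' m : {m : Fin d → ℤ // m ≠ 0}, freqNorm m.1 ^ (2 * s) * ‖a m.1‖ ^ 2) := by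
  classical
  have hlim : Tendsto (fun G : Finset (Fin d → ℤ) => ‖∑ m ∈ G, a m • e m - ∑ m ∈ F, a m • e m‖)
      atTop (𝓝 ‖f - ∑ m ∈ F, a m • e m‖) := (Tendsto.sub_const hf _).norm
  refine le_of_tendsto hlim ?_
  filter_upwards [eventually_ge_atTop F] with G hG
  rw [← Finset.sum_sdiff hG, add_sub_cancel_right, norm_sum_smul_orthonormal he]
  refine sqrt_sum_sq_le_rpow hs ha hR _ (fun m hm h0 => ?_) fun m hm => ?_
  · refine (Finset.mem_sdiff.mp hm).2 ((hF m).mpr ?_)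
    simp [h0, freqNorm, hR.le]
  · have := mt (hF m).mpr (Finset.mem_sdiff.mp hm).2
    exact (not_le.mp this).le

/-- Expand every wave and fix `k`: the dilation by `signedOdd k * c ≠ 0` is injective on
frequencies, so the exponentials remain orthonormal and the inner sum has exactly the `ℓ₂` norm of
`a`. The triangle inequality over `k` costs only `∑ oddWeight`, whatever the dimension. -/
lemma norm_sum_triangle_le {d : ℕ} {e T : (Fin d → ℤ) → H} (he : Orthonormal ℂ e)
    (hT : ∀ n, HasSum (fun k => (oddWeight k : ℂ) • e (signedOdd k • n)) (T n))
    (a : (Fin d → ℤ) → ℂ) (G : Finset (Fin d → ℤ)) {c : ℤ} (hc : c ≠ 0) :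
    ‖∑ m ∈ G, a m • T (c • m)‖ ≤ (∑' k, oddWeight k) * Real.sqrt (∑ m ∈ G, ‖a m‖ ^ 2) := by
  have h : HasSum (fun k => (oddWeight k : ℂ) • ∑ m ∈ G, a m • e (signedOdd k • c • m))
      (∑ m ∈ G, a m • T (c • m)) := by
    simp only [Finset.smul_sum]
    refine hasSum_sum fun m _ => ?_
    simp only [smul_comm _ (a m)]
    exact (hT (c • m)).const_smul (a m)
  rw [← h.tsum_eq]
  refine tsum_of_norm_bounded (summable_oddWeight.hasSum.mul_right _) fun k => ?_
  rw [norm_smul, Complex.norm_real, Real.norm_of_nonneg (oddWeight_nonneg k)]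
  by_cases hk : oddWeight k = 0
  · simp [hk]
  refine mul_le_mul_of_nonneg_left (le_of_eq ?_) (oddWeight_nonneg k)
  have hinj : Function.Injective fun m : Fin d → ℤ => signedOdd k • c • m := by
    intro m n hmn
    simp only [smul_smul] at hmn
    exact smul_right_injective _ (mul_ne_zero (signedOdd_ne_zero hk) hc) hmn
  exact norm_sum_smul_orthonormal (he.comp _ hinj) a G

open ArithmeticFunction in
/-- Triangle waves with frequencies in a ball of radius `R` approximate a function of smoothness
`s < 1` with error `O(R^{-s})`, with a constant that does not depend on the dimension. -/
theorem exists_triangle_sum_approx [CompleteSpace H] {d : ℕ} {e T : (Fin d → ℤ) → H}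
    (he : Orthonormal ℂ e)
    (hT : ∀ n, HasSum (fun k => (oddWeight k : ℂ) • e (signedOdd k • n)) (T n)) {s : ℝ}
    (hs0 : 0 < s) (hs1 : s < 1) {a : (Fin d → ℤ) → ℂ} {f : H}
    (hf : HasSum (fun m => a m • e m) f)
    (ha : Summable fun m : {m : Fin d → ℤ // m ≠ 0} => freqNorm m.1 ^ (2 * s) * ‖a m.1‖ ^ 2)
    {R : ℝ} (hR : 0 < R) (F : Finset (Fin d → ℤ)) (hF : ∀ m, m ∈ F ↔ freqNorm m ≤ R) :
    ∃ b : (Fin d → ℤ) → ℂ, ‖f - (a 0 • e 0 + ∑ n ∈ F, b n • T n)‖ ≤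
      (1 + (∑' k, oddWeight k) * ∑' k : ℕ, oddWeight k * (k : ℝ) ^ s) * R ^ (-s) *
        Real.sqrt (‖a 0‖ ^ 2 +
          ∑' m : {m : Fin d → ℤ // m ≠ 0}, freqNorm m.1 ^ (2 * s) * ‖a m.1‖ ^ 2) := by
  classical
  set S := Real.sqrt (‖a 0‖ ^ 2 +
    ∑' m : {m : Fin d → ℤ // m ≠ 0}, freqNorm m.1 ^ (2 * s) * ‖a m.1‖ ^ 2) with hS
  set c : ℕ → ℂ := fun k => ((moebius k : ℤ) : ℂ) * (oddWeight k : ℂ) with hc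
  set K := Finset.range (⌊R⌋₊ + 1) with hK
  -- Frequency `0` is kept as a constant: the cut-off `k * freqNorm m ≤ R` would not bound `k`
  -- there.
  set F' := F.erase 0 with hF'
  set g : H := ∑ m ∈ F', a m • ∑ k ∈ K,
    (if k * freqNorm m ≤ R then c k • T (signedOdd k • m) else 0) with hg
  have hgspan : g ∈ Submodule.span ℂ (T '' F) := by
    refine Submodule.sum_mem _ fun m _ => Submodule.smul_mem _ _ (Submodule.sum_mem _ fun k _ => ?_)
    split_ifs with h
    · refine Submodule.smul_mem _ _ (Submodule.subset_span ⟨_, ?_, rfl⟩)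
      refine Finset.mem_coe.mpr ((hF _).mpr ?_)
      rw [freqNorm_zsmul]
      exact (mul_le_mul_of_nonneg_right (abs_signedOdd_le k) (freqNorm_nonneg m)).trans h
    · exact Submodule.zero_mem _
  -- Different pairs `(m, k)` may give the same frequency; membership in the span merges their
  -- coefficients.
  obtain ⟨b, hb⟩ := Submodule.mem_span_image_finset_iff_exists_fun' ℂ |>.mp hgspan
  refine ⟨b, ?_⟩
  rw [hb]
  have h0F : (0 : Fin d → ℤ) ∈ F := (hF 0).mpr (by simp [freqNorm, hR.le])
  have hterm : ∀ m ∈ F', HasSum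
      (fun k : ℕ => if k * freqNorm m ≤ R then 0 else c k • T (signedOdd k • m))
      (e m - ∑ k ∈ K, (if k * freqNorm m ≤ R then c k • T (signedOdd k • m) else 0)) := by
    intro m hm
    have hm0 : m ≠ 0 := Finset.ne_of_mem_erase hm
    have h1 : HasSum (fun k => c k • T (signedOdd k • m)) (e m) := by
      have := hasSum_moebius_inversion (fun l : ℤ => e (l • m)) (fun l => T (l • m))
        (fun l => (he.1 _).le) (fun l => by simpa only [mul_smul] using hT (l • m))
      simpa only [one_smul] using this
    have h2 : HasSum (fun k : ℕ => if k * freqNorm m ≤ R then c k • T (signedOdd k • m) else 0)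
        (∑ k ∈ K, (if k * freqNorm m ≤ R then c k • T (signedOdd k • m) else 0)) := by
      refine hasSum_sum_of_ne_finset_zero fun k hk => if_neg fun h => hk ?_
      rw [hK, Finset.mem_range, Nat.lt_succ_iff]
      refine Nat.le_floor (le_trans ?_ h)
      exact le_mul_of_one_le_right (Nat.cast_nonneg _) (one_le_freqNorm hm0)
    convert h1.sub h2 using 2 with k
    split_ifs <;> simp
  have hsum := hasSum_sum fun m hm => (hterm m hm).const_smul (a m)
  simp only [smul_sub, Finset.sum_sub_distrib] at hsum
  rw [← hg] at hsum
  have hmain : ‖∑ m ∈ F', a m • e m - g‖ ≤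
      ((∑' k, oddWeight k) * ∑' k : ℕ, oddWeight k * (k : ℝ) ^ s) * R ^ (-s) * S := by
    rw [← hsum.tsum_eq]
    have hB := ((summable_oddWeight_mul_rpow hs1).hasSum.mul_left (∑' k, oddWeight k)).mul_right
      (R ^ (-s) * S)
    rw [mul_assoc _ _ S]
    -- Only frequencies above `R / k` survive in the `k`-th term, so smoothness gives `(R / k) ^
    -- (-s)`; the loss `k ^ s` is absorbed by `oddWeight k`.
    refine tsum_of_norm_bounded hB fun k => ?_
    have h1 : ∑ m ∈ F', a m • (if k * freqNorm m ≤ R then 0 else c k • T (signedOdd k • m)) =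
        c k • ∑ m ∈ F' with ¬ (k * freqNorm m ≤ R), a m • T (signedOdd k • m) := by
      rw [Finset.sum_filter, Finset.smul_sum]
      refine Finset.sum_congr rfl fun m _ => ?_
      split_ifs
      · simp
      · rw [smul_comm]
    rw [h1, norm_smul]
    by_cases hk : oddWeight k = 0
    · simp [hc, hk]
    have hk0 : (0 : ℝ) < k := by
      rcases Nat.eq_zero_or_pos k with rfl | h
      · exact absurd oddWeight_zero hk
      · exact_mod_cast h
    have h2 := norm_sum_triangle_le he hT a (F'.filter fun m => ¬ (k * freqNorm m ≤ R))
      (signedOdd_ne_zero hk)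
    have h3 : Real.sqrt (∑ m ∈ F' with ¬ (k * freqNorm m ≤ R), ‖a m‖ ^ 2) ≤
        (R / k) ^ (-s) * S := by
      refine sqrt_sum_sq_le_rpow hs0 ha (by positivity) _ (fun m hm => ?_) fun m hm => ?_
      · exact Finset.ne_of_mem_erase (Finset.mem_filter.mp hm).1
      · rw [div_le_iff₀' hk0]
        exact (not_le.mp (Finset.mem_filter.mp hm).2).le
    rw [Real.div_rpow hR.le hk0.le, Real.rpow_neg hk0.le, div_inv_eq_mul] at h3
    have hU : 0 ≤ ∑' k, oddWeight k := tsum_nonneg oddWeight_nonneg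
    calc ‖c k‖ * ‖∑ m ∈ F' with ¬ (k * freqNorm m ≤ R), a m • T (signedOdd k • m)‖
        ≤ oddWeight k * ((∑' k, oddWeight k) * (R ^ (-s) * (k : ℝ) ^ s * S)) := by
          refine mul_le_mul (norm_moebius_mul_le k)
            (h2.trans (mul_le_mul_of_nonneg_left h3 hU)) (norm_nonneg _) (oddWeight_nonneg k)
      _ = _ := by ring
  have hsplit : f - (a 0 • e 0 + g) =
      (f - ∑ m ∈ F, a m • e m) + (∑ m ∈ F', a m • e m - g) := by
    rw [← Finset.add_sum_erase F _ h0F]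
    abel
  rw [hsplit]
  refine (norm_add_le _ _).trans ?_
  have h4 := norm_sub_sum_le_rpow he hs0 hf ha hR F hF
  rw [← hS] at h4
  calc _ ≤ R ^ (-s) * S + _ := add_le_add h4 hmain
    _ = _ := by ring

end Hilbert

/-! ### The triangle wave -/

/-- The triangle wave of period one: twice the distance to the nearest integer. -/
def triWave (t : ℝ) : ℝ := 2 * |t - round t|

lemma triWave_add_int (t : ℝ) (n : ℤ) : triWave (t + n) = triWave t := by
  simp only [triWave, round_add_intCast]
  push_cast
  ring_nf

lemma triWave_eq_of_le_half {t : ℝ} (h : |t| ≤ 1 / 2) : triWave t = 2 * |t| := by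
  have h1 := round_le t 0
  simp only [Int.cast_zero, sub_zero] at h1
  have h2 : |(round t : ℝ)| ≤ |t - round t| + |t| := by
    have := abs_sub_abs_le_abs_sub (round t : ℝ) t
    rw [abs_sub_comm] at this
    linarith
  rw [triWave]
  by_cases hr : round t = 0
  · simp [hr]
  -- Rounding away from `0` is possible only at `|t| = 1 / 2`, where both distances agree.
  · have h3 : (1 : ℝ) ≤ |(round t : ℝ)| := by exact_mod_cast Int.one_le_abs hr
    congr 1
    linarith

lemma triWave_of_mem_Icc {t : ℝ} (h0 : 0 ≤ t) (h1 : t ≤ 1) : triWave t = 1 - |1 - 2 * t| := by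
  rcases le_total t (1 / 2) with h | h
  · rw [triWave_eq_of_le_half (by rwa [abs_of_nonneg h0]), abs_of_nonneg h0,
      abs_of_nonneg (by linarith)]
    ring
  · have h2 := triWave_add_int (t - 1) 1
    rw [Int.cast_one, sub_add_cancel] at h2
    rw [h2, triWave_eq_of_le_half (by rw [abs_le]; constructor <;> linarith),
      abs_of_nonpos (by linarith), abs_of_nonpos (by linarith)]
    ring

lemma triWave_fract (t : ℝ) : triWave (Int.fract t) = triWave t := by
  have := triWave_add_int (Int.fract t) ⌊t⌋
  rw [Int.fract_add_floor] at this
  exact this.symm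

lemma triWave_nonneg (t : ℝ) : 0 ≤ triWave t := by unfold triWave; positivity

lemma triWave_le_one (t : ℝ) : triWave t ≤ 1 := by
  have := abs_sub_round t
  unfold triWave
  linarith

lemma triWave_two_mul_fract (t : ℝ) : triWave (2 * Int.fract t) = triWave (2 * t) := by
  have := triWave_add_int (2 * Int.fract t) (2 * ⌊t⌋)
  rw [← this]
  congr 1
  push_cast
  rw [← mul_add, Int.fract_add_floor]

lemma triWave_two_mul_of_le_half {t : ℝ} (h0 : 0 ≤ t) (h1 : t ≤ 1 / 2) :
    triWave (2 * t) = 1 - |1 - 4 * t| := by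
  rw [triWave_of_mem_Icc (by linarith) (by linarith)]
  ring_nf

lemma triWave_two_mul_of_half_le {t : ℝ} (h0 : 1 / 2 ≤ t) (h1 : t ≤ 1) :
    triWave (2 * t) = 1 - |3 - 4 * t| := by
  have := triWave_add_int (2 * t - 1) 1
  rw [Int.cast_one, sub_add_cancel] at this
  rw [this, triWave_of_mem_Icc (by linarith) (by linarith)]
  ring_nf

/-- Doubling the argument amounts to composing with the tent map. -/
lemma triWave_triWave (t : ℝ) : triWave (triWave t) = triWave (2 * t) := by
  rw [← triWave_fract t, ← triWave_two_mul_fract]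
  have h0 := Int.fract_nonneg t
  have h1 := (Int.fract_lt_one t).le
  set y := Int.fract t
  rw [triWave_of_mem_Icc (triWave_nonneg y) (triWave_le_one y), triWave_of_mem_Icc h0 h1]
  rcases le_total y (1 / 2) with hy | hy
  · rw [triWave_two_mul_of_le_half h0 hy, abs_of_nonneg (by linarith : 0 ≤ 1 - 2 * y)]
    ring_nf
  · rw [triWave_two_mul_of_half_le hy h1, abs_of_nonpos (by linarith : 1 - 2 * y ≤ 0),
      abs_sub_comm 3]
    ring_nf

lemma continuous_triWave : Continuous triWave := by
  have h : triWave = (fun y => 1 - |1 - 2 * y|) ∘ Int.fract := by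
    funext t
    rw [← triWave_fract]
    exact triWave_of_mem_Icc (Int.fract_nonneg t) (Int.fract_lt_one t).le
  rw [h]
  exact ContinuousOn.comp_fract'' (f := fun y => 1 - |1 - 2 * y|) (by fun_prop) (by norm_num)

/-! ### Fourier series of the triangle wave -/

lemma HasSum.of_forall_eq {ι E : Type*} [AddCommMonoid E] [TopologicalSpace E] {f g : ι → E}
    {a : E} (h : HasSum g a) (hfg : ∀ i, f i = g i) : HasSum f a := by
  rwa [funext hfg]

lemma cos_two_pi_nat_mul_fract (k : ℕ) (t : ℝ) :
    Real.cos (2 * Real.pi * k * Int.fract t) = Real.cos (2 * Real.pi * k * t) := by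
  rw [← Real.cos_sub_int_mul_two_pi (2 * Real.pi * k * t) (k * ⌊t⌋), Int.fract]
  congr 1
  push_cast
  ring

lemma hasSum_cos_div_sq {t : ℝ} (h0 : 0 ≤ t) (h1 : t ≤ 1) :
    HasSum (fun n : ℕ => 1 / (n : ℝ) ^ 2 * Real.cos (2 * Real.pi * n * t))
      (Real.pi ^ 2 * (t ^ 2 - t + 1 / 6)) := by
  have h := hasSum_one_div_nat_pow_mul_cos one_ne_zero (x := t) ⟨h0, h1⟩
  have hb := bernoulliFun_two t
  rw [bernoulliFun] at hb
  rw [mul_one, hb] at h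
  convert h using 1
  simp only [Nat.factorial]
  push_cast
  ring

/-- The odd terms are the full series at `t` minus a quarter of the series at `2 * t`. The squares
in the two Bernoulli quadratics cancel, leaving a linear function on each half period. In `key`, `z`
is `2 * y` reduced modulo `1`. -/
lemma hasSum_oddWeight_cos (t : ℝ) :
    HasSum (fun k : ℕ => oddWeight k * Real.cos (2 * Real.pi * k * t))
      (Real.pi ^ 2 / 8 * (1 - 2 * triWave t)) := by
  have key : ∀ y z : ℝ, 0 ≤ y → y ≤ 1 → 0 ≤ z → z ≤ 1 →
      (∀ k : ℕ, Real.cos (2 * Real.pi * k * z) = Real.cos (2 * Real.pi * k * (2 * y))) →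
      HasSum (fun k : ℕ => oddWeight k * Real.cos (2 * Real.pi * k * y))
        (Real.pi ^ 2 * (y ^ 2 - y + 1 / 6) - 1 / 4 * (Real.pi ^ 2 * (z ^ 2 - z + 1 / 6))) := by
    intro y z hy0 hy1 hz0 hz1 hyz
    have h1 := hasSum_cos_div_sq hy0 hy1
    have h2 := (hasSum_cos_div_sq hz0 hz1).mul_left (1 / 4)
    have hinj : Function.Injective fun n : ℕ => 2 * n := fun a b h => by
      simpa using h
    have h3 : HasSum (fun k : ℕ => if Even k then
        1 / (k : ℝ) ^ 2 * Real.cos (2 * Real.pi * k * y) else 0)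
        (1 / 4 * (Real.pi ^ 2 * (z ^ 2 - z + 1 / 6))) := by
      rw [← hinj.hasSum_iff]
      · refine h2.of_forall_eq fun n => ?_
        simp only [Function.comp_apply, even_two_mul, if_true, hyz]
        push_cast
        rw [mul_pow, ← mul_assoc (1 / 4 : ℝ), one_div_mul_one_div]
        congr 2 <;> ring
      · intro k hk
        refine if_neg fun h => hk ?_
        obtain ⟨r, hr⟩ := h
        exact ⟨r, show 2 * r = k by lia⟩
    refine (h1.sub h3).of_forall_eq fun k => ?_
    have hw : oddWeight k = |((ZMod.χ₄ (k : ZMod 4) : ℤ) : ℝ)| / (k : ℝ) ^ 2 := rfl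
    rw [hw, ZMod.χ₄_nat_eq_if_mod_four]
    by_cases hk : Even k
    · have : k % 2 = 0 := Nat.even_iff.mp hk
      simp [hk, this]
    · have : k % 2 = 1 := Nat.not_even_iff.mp hk
      simp only [this, if_neg hk]
      split_ifs <;> simp_all
  have h0 := Int.fract_nonneg t
  have h1 := (Int.fract_lt_one t).le
  simp only [← cos_two_pi_nat_mul_fract _ t]
  rw [← triWave_fract t, triWave_of_mem_Icc h0 h1]
  set y := Int.fract t
  rcases le_total y (1 / 2) with hy | hy
  · convert key y (2 * y) h0 h1 (by linarith) (by linarith) (fun k => rfl) using 1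
    rw [abs_of_nonneg (by linarith)]
    ring
  · convert key y (2 * y - 1) h0 h1 (by linarith) (by linarith) (fun k => ?_) using 1
    · rw [abs_of_nonpos (by linarith)]
      ring
    · rw [← Real.cos_sub_nat_mul_two_pi (2 * Real.pi * k * (2 * y)) k]
      congr 1
      ring

/-- The complex triangle wave with Fourier series `∑ k, oddWeight k * exp (2 π i signedOdd k t)`. -/
def complexTriWave (t : ℝ) : ℂ :=
  ((Real.pi ^ 2 / 8 * (1 - 2 * triWave t) : ℝ) : ℂ) +
    ((Real.pi ^ 2 / 8 * (1 - 2 * triWave (t + 3 / 4)) : ℝ) : ℂ) * Complex.I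

/-- For odd `k`, `3 * k / 4` is congruent to `-χ₄(k) / 4` modulo `1`, so the shift by `3 / 4` turns
the cosine into the sine of the signed frequency. Without the signs the imaginary part would be `∑
sin (2πkt) / k²` over odd `k`, which is not piecewise linear. -/
lemma oddWeight_mul_exp (k : ℕ) (t : ℝ) :
    (oddWeight k : ℂ) * Complex.exp (2 * Real.pi * Complex.I * ((signedOdd k * t : ℝ) : ℂ)) =
      ((oddWeight k * Real.cos (2 * Real.pi * k * t) : ℝ) : ℂ) +
        ((oddWeight k * Real.cos (2 * Real.pi * k * (t + 3 / 4)) : ℝ) : ℂ) * Complex.I := by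
  have h : (2 * Real.pi * Complex.I * ((signedOdd k * t : ℝ) : ℂ)) =
      ((2 * Real.pi * (signedOdd k * t) : ℝ) : ℂ) * Complex.I := by
    push_cast
    ring
  rw [h, Complex.exp_mul_I, ← Complex.ofReal_cos, ← Complex.ofReal_sin]
  have h4 : k % 4 + 4 * (k / 4) = k := Nat.mod_add_div k 4
  have h5 : k % 4 < 4 := Nat.mod_lt _ (by norm_num)
  set q := k / 4
  have hcases : k % 2 = 0 ∨ k = 4 * q + 1 ∨ k = 4 * q + 3 := by lia
  rcases hcases with hk | hk | hk
  · have : oddWeight k = 0 := by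
      rw [oddWeight, ZMod.χ₄_nat_eq_if_mod_four, if_pos hk]
      simp
    simp [this]
  · have hχ : ZMod.χ₄ (k : ZMod 4) = 1 := ZMod.χ₄_nat_one_mod_four (by lia)
    have hs : (signedOdd k : ℝ) = k := by simp [signedOdd, hχ]
    have hc : Real.cos (2 * Real.pi * k * (t + 3 / 4)) = Real.sin (2 * Real.pi * (k * t)) := by
      rw [← Real.cos_sub_nat_mul_two_pi _ (3 * q + 1), ← Real.cos_sub_pi_div_two]
      congr 1
      rw [hk]
      push_cast
      ring
    rw [hs, hc, ← mul_assoc (2 * Real.pi)]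
    push_cast
    ring
  · have hχ : ZMod.χ₄ (k : ZMod 4) = -1 := ZMod.χ₄_nat_three_mod_four (by lia)
    have hs : (signedOdd k : ℝ) = -k := by simp [signedOdd, hχ]
    have hc : Real.cos (2 * Real.pi * k * (t + 3 / 4)) = -Real.sin (2 * Real.pi * (k * t)) := by
      rw [← Real.cos_sub_nat_mul_two_pi _ (3 * q + 2), ← Real.cos_add_pi_div_two]
      congr 1
      rw [hk]
      push_cast
      ring
    rw [hs, hc, show 2 * Real.pi * (-(k : ℝ) * t) = -(2 * Real.pi * (k * t)) by ring,
      Real.cos_neg, Real.sin_neg, mul_assoc (2 * Real.pi)]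
    push_cast
    ring

lemma hasSum_complexTriWave (t : ℝ) :
    HasSum (fun k : ℕ =>
      (oddWeight k : ℂ) * Complex.exp (2 * Real.pi * Complex.I * ((signedOdd k * t : ℝ) : ℂ)))
      (complexTriWave t) := by
  simp only [oddWeight_mul_exp]
  exact (Complex.hasSum_ofReal.mpr (hasSum_oddWeight_cos t)).add
    ((Complex.hasSum_ofReal.mpr (hasSum_oddWeight_cos (t + 3 / 4))).mul_right _)

lemma continuous_complexTriWave : Continuous complexTriWave := by
  have := continuous_triWave
  unfold complexTriWave
  fun_prop

lemma norm_complexTriWave_le (t : ℝ) : ‖complexTriWave t‖ ≤ ∑' k, oddWeight k := by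
  rw [← (hasSum_complexTriWave t).tsum_eq]
  refine tsum_of_norm_bounded summable_oddWeight.hasSum fun k => ?_
  rw [norm_mul, Complex.norm_real, Real.norm_of_nonneg (oddWeight_nonneg k),
    show (2 * Real.pi * Complex.I * ((signedOdd k * t : ℝ) : ℂ)) =
      ((2 * Real.pi * (signedOdd k * t) : ℝ) : ℂ) * Complex.I by push_cast; ring,
    Complex.norm_exp_ofReal_mul_I, mul_one]

/-- The triangle wave `x ↦ T(n · x)` on the cube. -/
def triRidge {d : ℕ} (n : Fin d → ℤ) (x : Fin d → ℝ) : ℂ := complexTriWave (∑ i, (n i : ℝ) * x i)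

lemma memLp_triRidge {d : ℕ} (n : Fin d → ℤ) : MemLp (triRidge n) 2 (cubeMeasure d) := by
  refine memLp_of_continuous_bounded ?_ _ fun x => norm_complexTriWave_le _
  unfold triRidge
  have := continuous_complexTriWave
  fun_prop

/-- The series converges uniformly by the Weierstrass test, and on a probability space uniform
bounds control the `L₂` norm. -/
lemma hasSum_triRidge_toLp {d : ℕ} (n : Fin d → ℤ) :
    HasSum (fun k => (oddWeight k : ℂ) • expLp (signedOdd k • n)) (memLp_triRidge n).toLp := by
  refine hasSum_smul_toLp (memLp_triRidge n) (fun k => memLp_fourierExp (signedOdd k • n)) _ ?_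
  have hpt : ∀ x : Fin d → ℝ, HasSum
      (fun k => (oddWeight k : ℂ) * fourierExp (signedOdd k • n) x) (triRidge n x) := by
    intro x
    refine (hasSum_complexTriWave (∑ i, (n i : ℝ) * x i)).of_forall_eq fun k => ?_
    rw [fourierExp, Finset.mul_sum]
    congr 4
    exact Finset.sum_congr rfl fun i _ => by
      simp only [Pi.smul_apply, smul_eq_mul, Int.cast_mul]
      ring
  have hu := tendstoUniformly_tsum summable_oddWeight
    (f := fun k (x : Fin d → ℝ) => (oddWeight k : ℂ) * fourierExp (signedOdd k • n) x)
    fun k x => by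
      rw [norm_mul, norm_fourierExp, mul_one, Complex.norm_real,
        Real.norm_of_nonneg (oddWeight_nonneg k)]
  simp only [fun x => (hpt x).tsum_eq] at hu
  rw [Metric.tendstoUniformly_iff] at hu
  rw [ENNReal.tendsto_nhds_zero]
  intro δ hδ
  obtain ⟨δ', hδ'0, hδ'⟩ := ENNReal.lt_iff_exists_nnreal_btwn.mp hδ
  filter_upwards [hu δ' (by exact_mod_cast hδ'0)] with F hF
  refine le_trans ?_ hδ'.le
  have := eLpNorm_le_of_ae_bound (p := 2) (μ := cubeMeasure d)
    (f := fun x => triRidge n x - ∑ k ∈ F, (oddWeight k : ℂ) * fourierExp (signedOdd k • n) x)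
    (C := (δ' : ℝ)) (Eventually.of_forall fun x => by
      rw [← dist_eq_norm]
      exact (hF x).le)
  simpa using this

/-! ### Counting lattice points -/

lemma sum_natAbs_le_freqNorm_sq {d : ℕ} (m : Fin d → ℤ) :
    ((∑ i, (m i).natAbs : ℕ) : ℝ) ≤ freqNorm m ^ 2 := by
  rw [freqNorm, Real.sq_sqrt (Finset.sum_nonneg fun i _ => sq_nonneg _), Nat.cast_sum]
  refine Finset.sum_le_sum fun i _ => ?_
  have h : ((m i).natAbs : ℤ) ≤ m i ^ 2 := Int.natAbs_le_self_sq (m i)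
  have h' : (((m i).natAbs : ℤ) : ℝ) ≤ ((m i ^ 2 : ℤ) : ℝ) := Int.cast_le.mpr h
  rwa [Int.cast_natCast, Int.cast_pow] at h'

lemma sum_natAbs_le_sqrt_mul_freqNorm {d : ℕ} (m : Fin d → ℤ) :
    ((∑ i, (m i).natAbs : ℕ) : ℝ) ≤ Real.sqrt d * freqNorm m := by
  rw [freqNorm, ← Real.sqrt_mul (Nat.cast_nonneg d)]
  refine Real.le_sqrt_of_sq_le ?_
  have h := sq_sum_le_card_mul_sum_sq (s := (Finset.univ : Finset (Fin d)))
    (f := fun i => ((m i).natAbs : ℝ))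
  simp only [Finset.card_univ, Fintype.card_fin] at h
  push_cast
  refine h.trans_eq ?_
  congr 1
  exact Finset.sum_congr rfl fun i _ => by
    rw [Nat.cast_natAbs, Int.cast_abs, sq_abs]

lemma finite_freqNorm_le {d : ℕ} (R : ℝ) : {m : Fin d → ℤ | freqNorm m ≤ R}.Finite := by
  refine (Set.finite_Icc (fun _ : Fin d => -⌈R⌉) (fun _ => ⌈R⌉)).subset fun m hm => ?_
  have h : ∀ i, |(m i : ℝ)| ≤ ⌈R⌉ := fun i => by
    refine le_trans ?_ (le_trans (show freqNorm m ≤ R from hm) (Int.le_ceil R))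
    refine Real.abs_le_sqrt ?_
    exact Finset.single_le_sum (f := fun i => (m i : ℝ) ^ 2) (fun i _ => sq_nonneg _)
      (Finset.mem_univ i)
  have h' : ∀ i, |m i| ≤ ⌈R⌉ := fun i => by exact_mod_cast h i
  exact ⟨fun i => (abs_le.mp (h' i)).1, fun i => (abs_le.mp (h' i)).2⟩

/-- The frequencies in the Euclidean ball of radius `R`. -/
def freqBall (d : ℕ) (R : ℝ) : Finset (Fin d → ℤ) := (finite_freqNorm_le R).toFinset

lemma mem_freqBall {d : ℕ} {R : ℝ} {m : Fin d → ℤ} : m ∈ freqBall d R ↔ freqNorm m ≤ R := by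
  simp [freqBall]

lemma sum_Icc_pow_natAbs_le {q : ℝ} (h0 : 0 ≤ q) (h1 : q < 1) (K : ℕ) :
    ∑ k ∈ Finset.Icc (-(K : ℤ)) K, q ^ k.natAbs ≤ (1 + q) / (1 - q) := by
  have h2 : 0 < 1 - q := by linarith
  -- The exact remainder is carried along so that the induction closes.
  suffices h : ∑ k ∈ Finset.Icc (-(K : ℤ)) K, q ^ k.natAbs =
      (1 + q) / (1 - q) - 2 * q ^ (K + 1) / (1 - q) by
    rw [h]
    have : 0 ≤ 2 * q ^ (K + 1) / (1 - q) := by positivity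
    linarith
  induction K with
  | zero =>
    simp
    field_simp
    ring
  | succ K ih =>
    have hI : Finset.Icc (-((K + 1 : ℕ) : ℤ)) ((K + 1 : ℕ) : ℤ) =
        insert (-((K + 1 : ℕ) : ℤ)) (insert ((K + 1 : ℕ) : ℤ) (Finset.Icc (-(K : ℤ)) K)) := by
      ext k
      simp only [Finset.mem_Icc, Finset.mem_insert]
      lia
    rw [hI, Finset.sum_insert (by simp only [Finset.mem_insert, Finset.mem_Icc]; lia),
      Finset.sum_insert (by simp only [Finset.mem_Icc]; lia), ih, Int.natAbs_neg, Int.natAbs_natCast]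
    field_simp
    ring

/-- A generating function bound for the number of integer points in an `ℓ₁` ball. -/
lemma card_mul_rpow_le {d : ℕ} (F : Finset (Fin d → ℤ)) {B q : ℝ} (h0 : 0 < q) (h1 : q < 1)
    (hF : ∀ m ∈ F, ((∑ i, (m i).natAbs : ℕ) : ℝ) ≤ B) :
    (F.card : ℝ) * q ^ B ≤ ((1 + q) / (1 - q)) ^ d := by
  classical
  obtain ⟨K, hK⟩ : ∃ K : ℕ, K = ⌊B⌋₊ := ⟨_, rfl⟩
  have hsub : F ⊆ Fintype.piFinset fun _ : Fin d => Finset.Icc (-(K : ℤ)) K := by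
    intro m hm
    rw [Fintype.mem_piFinset]
    intro i
    have h2 : (m i).natAbs ≤ K := by
      rw [hK]
      refine Nat.le_floor ((Nat.cast_le.mpr ?_).trans (hF m hm))
      exact Finset.single_le_sum (f := fun i => (m i).natAbs) (fun i _ => Nat.zero_le _)
        (Finset.mem_univ i)
    rw [Finset.mem_Icc]
    lia
  -- Each point of `F` has weight at least `q ^ B`; over the enclosing box the weights factor into
  -- one geometric sum per coordinate.
  have h2 : (F.card : ℝ) * q ^ B ≤ ∑ m ∈ F, ∏ i, q ^ (m i).natAbs := by
    rw [← nsmul_eq_mul]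
    refine Finset.card_nsmul_le_sum _ _ _ fun m hm => ?_
    rw [Finset.prod_pow_eq_pow_sum, ← Real.rpow_natCast]
    exact Real.rpow_le_rpow_of_exponent_ge h0 h1.le (hF m hm)
  have h3 := Finset.sum_le_sum_of_subset_of_nonneg
    (f := fun m : Fin d → ℤ => ∏ i, q ^ (m i).natAbs) hsub fun m _ _ =>
      Finset.prod_nonneg fun i _ => pow_nonneg h0.le _
  rw [← Finset.prod_univ_sum (fun _ => Finset.Icc (-(K : ℤ)) K)
    (fun (_ : Fin d) (k : ℤ) => q ^ k.natAbs), Finset.prod_const, Finset.card_univ,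
    Fintype.card_fin] at h3
  refine h2.trans (h3.trans (pow_le_pow_left₀ ?_ (sum_Icc_pow_natAbs_le h0.le h1 K) d))
  exact Finset.sum_nonneg fun k _ => pow_nonneg h0.le _

/-- The number of frequencies in a ball whose radius is large compared to the dimension. -/
lemma card_freqBall_le_pow {d : ℕ} (hd : 0 < d) {R : ℝ} (hR : Real.sqrt d ≤ R) :
    ((freqBall d R).card : ℝ) ≤ (9 * (R / Real.sqrt d)) ^ d := by
  have hd' : 0 < Real.sqrt d := Real.sqrt_pos.mpr (by exact_mod_cast hd)
  have hR0 : 0 < R := hd'.trans_le hR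
  -- With `q = exp (-lam)` and `B = √d * R`, `q ^ B` is `exp (-d)`. The base is then at most `e * (1
  -- + 2 / lam)`, and `1 + 2 / lam ≤ 3 * R / √d` together with `e ≤ 3` gives the factor `9`.
  set lam := Real.sqrt d / R with hlam
  have hlam0 : 0 < lam := by positivity
  have h := card_mul_rpow_le (freqBall d R) (B := Real.sqrt d * R) (q := Real.exp (-lam))
    (Real.exp_pos _) (by rw [Real.exp_lt_one_iff]; linarith) fun m hm =>
      (sum_natAbs_le_sqrt_mul_freqNorm m).trans
        (mul_le_mul_of_nonneg_left (mem_freqBall.mp hm) hd'.le)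
  have hexp : Real.exp (-lam) ^ (Real.sqrt d * R) = (Real.exp 1 ^ d)⁻¹ := by
    rw [← Real.exp_mul, ← Real.exp_nat_mul, ← Real.exp_neg]
    congr 1
    rw [hlam]
    field_simp
    rw [Real.sq_sqrt (Nat.cast_nonneg d)]
  rw [hexp, ← div_eq_mul_inv, div_le_iff₀ (by positivity), ← mul_pow] at h
  refine h.trans (pow_le_pow_left₀ ?_ ?_ d)
  · have : Real.exp (-lam) < 1 := by rw [Real.exp_lt_one_iff]; linarith
    have : 0 < 1 - Real.exp (-lam) := by linarith
    positivity
  · have hratio : (1 + Real.exp (-lam)) / (1 - Real.exp (-lam)) ≤ 1 + 2 / lam := by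
      have h2 : lam + 1 ≤ Real.exp lam := Real.add_one_le_exp lam
      have h3 : Real.exp (-lam) * Real.exp lam = 1 := by rw [← Real.exp_add]; simp
      have h4 : Real.exp (-lam) < 1 := by rw [Real.exp_lt_one_iff]; linarith
      have h5 : 0 < Real.exp (-lam) := Real.exp_pos _
      rw [div_le_iff₀ (by linarith)]
      have h6 : Real.exp (-lam) * (lam + 1) ≤ 1 :=
        (mul_le_mul_of_nonneg_left h2 h5.le).trans h3.le
      have h7 : (1 + 2 / lam) * (1 - Real.exp (-lam)) - (1 + Real.exp (-lam)) =
          2 / lam * (1 - Real.exp (-lam) * (lam + 1)) := by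
        field_simp
        ring
      have h8 : 0 ≤ 2 / lam * (1 - Real.exp (-lam) * (lam + 1)) :=
        mul_nonneg (by positivity) (by linarith)
      linarith
    have hX : 1 ≤ R / Real.sqrt d := (one_le_div hd').mpr hR
    have hinv : 2 / lam = 2 * (R / Real.sqrt d) := by rw [hlam]; field_simp
    rw [hinv] at hratio
    have he : Real.exp 1 ≤ 3 := by linarith [Real.exp_one_lt_d9]
    calc _ ≤ (3 * (R / Real.sqrt d)) * 3 :=
          mul_le_mul (by linarith) he (Real.exp_pos _).le (by linarith)
      _ = _ := by ring

/-- The number of frequencies in a ball whose radius is small compared to the dimension. -/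
lemma card_freqBall_le_rpow {d : ℕ} {R q : ℝ} (hq0 : 0 < q) (hq1 : q ≤ 1 / 2) :
    ((freqBall d R).card : ℝ) ≤ (1 / q) ^ (R ^ 2) * Real.exp (4 * q * d) := by
  have h := card_mul_rpow_le (freqBall d R) (B := R ^ 2) hq0 (by linarith) fun m hm =>
      (sum_natAbs_le_freqNorm_sq m).trans
        (pow_le_pow_left₀ (freqNorm_nonneg m) (mem_freqBall.mp hm) 2)
  have h2 : (1 + q) / (1 - q) ≤ Real.exp (4 * q) := by
    refine le_trans ?_ (Real.add_one_le_exp _)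
    rw [div_le_iff₀ (by linarith)]
    nlinarith
  have h3 : ((1 + q) / (1 - q)) ^ d ≤ Real.exp (4 * q * d) := by
    rw [mul_comm (4 * q), Real.exp_nat_mul]
    exact pow_le_pow_left₀ (div_nonneg (by linarith) (by linarith)) h2 d
  rw [one_div, Real.inv_rpow hq0.le, ← div_eq_inv_mul, le_div_iff₀ (by positivity)]
  exact h.trans h3

/-! ### Realising sums of triangle waves by ReLU networks -/

section Network

variable {K κ : Type*} {d W L : ℕ}

/-- One layer: an affine map followed by the activation. -/
def reluLayer (y : K → ℝ) (A : (K → ℝ) →ᵃ[ℝ] (K → ℝ)) : K → ℝ := fun i => max (A y i) 0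

/-- Networks whose layers are indexed by an arbitrary finite type of size at most `W`. -/
lemma exists_reluNetwork_of_card_le [Fintype K] (hK : Fintype.card K ≤ W) (A₀ : (Fin d → ℝ) →ᵃ[ℝ] (K → ℝ))
    (l : List ((K → ℝ) →ᵃ[ℝ] (K → ℝ))) (hl : l.length = L - 1) (out : (K → ℝ) →ᵃ[ℝ] ℝ) :
    ∃ N : ReLUNetwork d W L, ∀ x,
      N.eval x = out (l.foldl reluLayer fun i => max (A₀ x i) 0) := by
  obtain ⟨φ⟩ := Function.Embedding.nonempty_of_card_le (α := K) (β := Fin W) (by simpa using hK)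
  set E : (K → ℝ) →ₗ[ℝ] (Fin W → ℝ) := Function.ExtendByZero.linearMap ℝ φ with hE
  set P : (Fin W → ℝ) →ₗ[ℝ] (K → ℝ) := LinearMap.funLeft ℝ ℝ φ with hP
  have hPE : ∀ y i, E y (φ i) = y i := fun y i => φ.injective.extend_apply y 0 i
  have hPap : ∀ y i, P y i = y (φ i) := fun y i => rfl
  set lift : ((K → ℝ) →ᵃ[ℝ] (K → ℝ)) → ((Fin W → ℝ) →ᵃ[ℝ] (Fin W → ℝ)) := fun A =>
    E.toAffineMap.comp (A.comp P.toAffineMap) with hlift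
  have hfold : ∀ (l : List ((K → ℝ) →ᵃ[ℝ] (K → ℝ))) (y : Fin W → ℝ),
      P ((l.map lift).foldl (fun y A => reluVec (A y)) y) = l.foldl reluLayer (P y) := by
    intro l
    induction l with
    | nil => intro y; rfl
    | cons A l ih =>
      intro y
      simp only [List.map_cons, List.foldl_cons]
      rw [ih]
      congr 1
      funext i
      rw [hPap]
      change max (E (A (P y)) (φ i)) 0 = max (A (P y) i) 0
      rw [hPE]
  refine ⟨⟨E.toAffineMap.comp A₀, fun j => lift (l.get (j.cast hl.symm)),
    out.comp P.toAffineMap⟩, fun x => ?_⟩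
  have hof : List.ofFn (fun j : Fin (L - 1) => lift (l.get (j.cast hl.symm))) = l.map lift := by
    refine List.ext_getElem (by simp [hl]) fun i h1 h2 => ?_
    simp
  rw [ReLUNetwork.eval]
  change out (P _) = _
  rw [hof, hfold]
  congr 2
  funext i
  rw [hPap]
  change max (E (A₀ x) (φ i)) 0 = _
  rw [hPE]

lemma foldl_replicate_id (n : ℕ) {y : K → ℝ} (hy : ∀ i, 0 ≤ y i) :
    (List.replicate n (AffineMap.id ℝ (K → ℝ))).foldl reluLayer y = y := by
  induction n with
  | zero => rfl
  | succ n ih =>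
    rw [List.replicate_succ, List.foldl_cons]
    have : reluLayer y (AffineMap.id ℝ (K → ℝ)) = y := funext fun i => max_eq_left (hy i)
    rw [this, ih]

/-- The output layer `y ↦ c + ∑ i, v i * y i`. -/
def weightedSum [Fintype K] (c : ℝ) (v : K → ℝ) : (K → ℝ) →ᵃ[ℝ] ℝ :=
  AffineMap.const ℝ _ c + (∑ i, v i • (LinearMap.proj i : (K → ℝ) →ₗ[ℝ] ℝ)).toAffineMap

lemma weightedSum_apply [Fintype K] (c : ℝ) (v y : K → ℝ) : weightedSum c v y = c + ∑ i, v i * y i := by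
  simp [weightedSum]

lemma two_relu_sub_four_relu {z : ℝ} (h0 : 0 ≤ z) (h1 : z ≤ 1) :
    2 * max (z - 0) 0 - 4 * max (z - 1 / 2) 0 = triWave z := by
  rw [triWave_of_mem_Icc h0 h1]
  rcases le_total z (1 / 2) with h | h
  · rw [max_eq_left (by linarith), max_eq_right (by linarith), abs_of_nonneg (by linarith)]
    ring
  · rw [max_eq_left (by linarith), max_eq_left (by linarith), abs_of_nonpos (by linarith)]
    ring

lemma triWave_iterate (r : ℕ) (y : ℝ) : triWave^[r + 1] y = triWave (2 ^ r * y) := by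
  induction r with
  | zero => simp
  | succ r ih =>
    rw [Function.iterate_succ_apply', ih, triWave_triWave]
    ring_nf

/-- The thresholds of the two neurons computing one tent map. -/
def tentShift (b : Bool) : ℝ := if b then 1 / 2 else 0

/-- The weights of the two neurons computing one tent map. -/
def tentWeight (b : Bool) : ℝ := if b then -4 else 2

/-- The pair of neurons attached to every index `k`, fed with the value `y k`. -/
def tentState (y : κ → ℝ) : κ × Bool → ℝ := fun p => max (y p.1 - tentShift p.2) 0

/-- The affine map between two consecutive tent maps. -/
def tentMap : (κ × Bool → ℝ) →ᵃ[ℝ] (κ × Bool → ℝ) :=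
  AffineMap.pi fun p => (∑ b, tentWeight b • (LinearMap.proj (p.1, b) :
    (κ × Bool → ℝ) →ₗ[ℝ] ℝ)).toAffineMap - AffineMap.const ℝ _ (tentShift p.2)

lemma sum_tentWeight_mul_tentState {y : κ → ℝ} {k : κ} (hy : y k ∈ Set.Icc (0 : ℝ) 1) :
    ∑ b, tentWeight b * tentState y (k, b) = triWave (y k) := by
  rw [← two_relu_sub_four_relu hy.1 hy.2]
  simp [tentWeight, tentState, tentShift]
  ring

lemma foldl_replicate_tentMap (r : ℕ) {y : κ → ℝ} (hy : ∀ k, y k ∈ Set.Icc (0 : ℝ) 1) :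
    (List.replicate r tentMap).foldl reluLayer (tentState y) =
      tentState fun k => triWave^[r] (y k) := by
  induction r generalizing y with
  | zero => rfl
  | succ r ih =>
    rw [List.replicate_succ, List.foldl_cons]
    have h : reluLayer (tentState y) tentMap = tentState fun k => triWave (y k) := by
      funext p
      have h1 : tentMap (tentState y) p =
          ∑ b, tentWeight b * tentState y (p.1, b) - tentShift p.2 := by
        simp [tentMap]
      rw [reluLayer, h1, sum_tentWeight_mul_tentState (hy p.1)]
      rfl
    rw [h, ih fun k => ⟨triWave_nonneg _, triWave_le_one _⟩]
    rfl

/-- A network of depth `r + 1` with two neurons per wave realises triangle waves of frequency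
`2 ^ r`. -/
theorem exists_reluNetwork_deep [Fintype κ] {r : ℕ} (hW : 2 * Fintype.card κ ≤ W) (hL : r + 1 ≤ L)
    (Y : κ → (Fin d → ℝ) →ᵃ[ℝ] ℝ) (v : κ → ℝ) (c : ℝ) :
    ∃ N : ReLUNetwork d W L, ∀ x, (∀ k, Y k x ∈ Set.Icc (0 : ℝ) 1) →
      N.eval x = c + ∑ k, v k * triWave (2 ^ r * Y k x) := by
  obtain ⟨N, hN⟩ := exists_reluNetwork_of_card_le (K := κ × Bool) (W := W) (L := L)
    (by rw [Fintype.card_prod, Fintype.card_bool]; lia)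
    (AffineMap.pi fun p => Y p.1 - AffineMap.const ℝ _ (tentShift p.2))
    -- The input layer prepares the first tent and the output weights complete the last, so `r` tent
    -- layers give `r + 1` iterations, hence `2 ^ r`. The identity layers are harmless on
    -- nonnegative states.
    (List.replicate r tentMap ++ List.replicate (L - 1 - r) (AffineMap.id ℝ _))
    (by simp; lia) (weightedSum c fun p => v p.1 * tentWeight p.2)
  refine ⟨N, fun x hx => ?_⟩
  have h0 : (fun i : κ × Bool => max ((AffineMap.pi fun p : κ × Bool =>
      Y p.1 - AffineMap.const ℝ (Fin d → ℝ) (tentShift p.2)) x i) 0) =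
      tentState fun k => Y k x := rfl
  rw [hN, h0, List.foldl_append, foldl_replicate_tentMap r hx, foldl_replicate_id,
    weightedSum_apply, Fintype.sum_prod_type]
  · congr 1
    refine Finset.sum_congr rfl fun k _ => ?_
    simp only [mul_assoc]
    rw [← Finset.mul_sum, sum_tentWeight_mul_tentState, ← triWave_iterate,
      Function.iterate_succ_apply']
    cases r with
    | zero => exact hx k
    | succ r =>
      rw [Function.iterate_succ_apply']
      exact ⟨triWave_nonneg _, triWave_le_one _⟩
  · exact fun p => le_max_right _ _

/-- The coefficients of the triangle wave in terms of shifted activations. -/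
def waveCoeff (i : ℕ) : ℝ := if i = 0 then 2 else (-1) ^ i * 4

/-- At each positive half-integer the slope jumps by `±4`, alternating between `2` and `-2`; this is
the wave on `[n / 2, (n + 1) / 2]`, where all `n + 1` neurons are active. -/
lemma sum_waveCoeff_mul_sub (n : ℕ) (y : ℝ) :
    ∑ i ∈ Finset.range (n + 1), waveCoeff i * (y - i / 2) =
      if Even n then 2 * y - n else n + 1 - 2 * y := by
  induction n with
  | zero => simp [waveCoeff]
  | succ n ih =>
    rw [Finset.sum_range_succ, ih, waveCoeff, if_neg (Nat.succ_ne_zero n)]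
    by_cases h : Even n
    · have h' : ¬ Even (n + 1) := by rwa [Nat.even_add_one, not_not]
      rw [if_pos h, if_neg h', Odd.neg_one_pow (Nat.not_even_iff_odd.mp h')]
      push_cast
      ring
    · have h' : Even (n + 1) := Nat.even_add_one.mpr h
      rw [if_neg h, if_pos h', Even.neg_one_pow h']
      push_cast
      ring

lemma triWave_of_mem_half_Icc {n : ℕ} {y : ℝ} (h0 : (n : ℝ) / 2 ≤ y) (h1 : y ≤ (n + 1) / 2) :
    triWave y = if Even n then 2 * y - n else n + 1 - 2 * y := by
  rcases Nat.even_or_odd' n with ⟨p, rfl | rfl⟩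
  · rw [if_pos (even_two_mul p)]
    push_cast at h0 h1 ⊢
    have h := triWave_add_int (y - p) p
    rw [Int.cast_natCast, sub_add_cancel] at h
    rw [h, triWave_of_mem_Icc (by linarith) (by linarith), abs_of_nonneg (by linarith)]
    ring
  · rw [if_neg (by simp)]
    push_cast at h0 h1 ⊢
    have h := triWave_add_int (y - p) p
    rw [Int.cast_natCast, sub_add_cancel] at h
    rw [h, triWave_of_mem_Icc (by linarith) (by linarith), abs_of_nonpos (by linarith)]
    ring

lemma sum_waveCoeff_mul_relu (n : ℕ) {y : ℝ} (h0 : 0 ≤ y) (h1 : y ≤ (n + 1) / 2) :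
    ∑ i ∈ Finset.range (n + 1), waveCoeff i * max (y - i / 2) 0 = triWave y := by
  induction n with
  | zero =>
    rw [triWave_of_mem_half_Icc (n := 0) (by simpa using h0) h1]
    simp [waveCoeff, h0]
  | succ n ih =>
    rcases le_total y ((n + 1) / 2) with h | h
    · rw [Finset.sum_range_succ, ih h, max_eq_right (by push_cast; linarith)]
      ring
    · rw [triWave_of_mem_half_Icc (n := n + 1) (by push_cast; linarith) h1,
        ← sum_waveCoeff_mul_sub]
      refine Finset.sum_congr rfl fun i hi => ?_
      have hi' : (i : ℝ) ≤ n + 1 := by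
        exact_mod_cast Nat.lt_succ_iff.mp (Finset.mem_range.mp hi)
      rw [max_eq_left (by linarith)]

/-- A network of arbitrary positive depth realises triangle waves on `[0, (n + 1) / 2]`. -/
theorem exists_reluNetwork_shallow [Fintype κ] {n : ℕ} (hW : Fintype.card κ * (n + 1) ≤ W)
    (Y : κ → (Fin d → ℝ) →ᵃ[ℝ] ℝ) (v : κ → ℝ) (c : ℝ) :
    ∃ N : ReLUNetwork d W L, ∀ x, (∀ k, Y k x ∈ Set.Icc (0 : ℝ) ((n + 1) / 2)) →
      N.eval x = c + ∑ k, v k * triWave (Y k x) := by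
  obtain ⟨N, hN⟩ := exists_reluNetwork_of_card_le (K := κ × Fin (n + 1)) (W := W) (L := L)
    (by rwa [Fintype.card_prod, Fintype.card_fin])
    (AffineMap.pi fun p => Y p.1 - AffineMap.const ℝ _ ((p.2 : ℝ) / 2))
    (List.replicate (L - 1) (AffineMap.id ℝ _)) (by simp)
    (weightedSum c fun p => v p.1 * waveCoeff p.2)
  refine ⟨N, fun x hx => ?_⟩
  rw [hN, foldl_replicate_id, weightedSum_apply, Fintype.sum_prod_type]
  · congr 1
    refine Finset.sum_congr rfl fun k _ => ?_
    simp only [mul_assoc]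
    rw [← Finset.mul_sum, ← sum_waveCoeff_mul_relu n (hx k).1 (hx k).2, ← Fin.sum_univ_eq_sum_range
      (fun i => waveCoeff i * max (Y k x - i / 2) 0)]
    rfl
  · exact fun p => le_max_right _ _

end Network

/-! ### Approximation of Sobolev functions -/

/-- The dimension-free constant in the approximation by triangle waves. -/
def approxConst (s : ℝ) : ℝ :=
  1 + (∑' k, oddWeight k) * ∑' k : ℕ, oddWeight k * (k : ℝ) ^ s

lemma one_le_approxConst (s : ℝ) : 1 ≤ approxConst s :=
  le_add_of_nonneg_right (mul_nonneg (tsum_nonneg oddWeight_nonneg)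
    (tsum_nonneg fun k => mul_nonneg (oddWeight_nonneg k) (by positivity)))

/-- The phases `0` and `3 / 4` of the triangle waves. -/
def wavePhase (b : Bool) : ℝ := if b then 3 / 4 else 0

lemma re_mul_complexTriWave (z : ℂ) (t : ℝ) : (z * complexTriWave t).re =
    Real.pi ^ 2 / 8 * (z.re - z.im) + ((-(Real.pi ^ 2 / 4) * z.re) * triWave t +
      (Real.pi ^ 2 / 4 * z.im) * triWave (t + 3 / 4)) := by
  have h1 : (complexTriWave t).re = Real.pi ^ 2 / 8 * (1 - 2 * triWave t) := by
    simp [complexTriWave, -Complex.ofReal_mul, -Complex.ofReal_sub, -Complex.ofReal_div,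
      -Complex.ofReal_pow]
  have h2 : (complexTriWave t).im = Real.pi ^ 2 / 8 * (1 - 2 * triWave (t + 3 / 4)) := by
    simp [complexTriWave, -Complex.ofReal_mul, -Complex.ofReal_sub, -Complex.ofReal_div,
      -Complex.ofReal_pow]
  rw [Complex.mul_re, h1, h2]
  ring

/-- The real part of each complex term is a constant plus triangle waves of phases `0` and `3 / 4`.
As `f` is real, taking real parts cannot increase the error. -/
theorem exists_real_triangle_sum_approx {d : ℕ} {s : ℝ} (hs0 : 0 < s) (hs1 : s < 1)
    {f : (Fin d → ℝ) → ℝ} (hf : MemSobolev s f) {R : ℝ} (hR : 0 < R) :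
    ∃ (c : ℝ) (v : (freqBall d R) × Bool → ℝ),
      eLpNorm (fun x => f x - (c + ∑ k : (freqBall d R) × Bool,
        v k * triWave (∑ i, (k.1.1 i : ℝ) * x i + wavePhase k.2))) 2 (cubeMeasure d) ≤
      ENNReal.ofReal (approxConst s * R ^ (-s) * sobolevNorm s f) := by
  have hfC : MemLp (fun x => (f x : ℂ)) 2 (cubeMeasure d) := hf.memLp.ofReal
  have hsum : HasSum (fun m => cubeFourierCoeff f m • expLp m) hfC.toLp :=
    hasSum_smul_toLp hfC memLp_fourierExp _ hf.fourier
  obtain ⟨b, hb⟩ := exists_triangle_sum_approx (orthonormal_expLp d) hasSum_triRidge_toLp hs0 hs1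
    hsum hf.summable hR (freqBall d R) fun m => mem_freqBall
  set a₀ := cubeFourierCoeff f 0
  refine ⟨a₀.re + ∑ n ∈ freqBall d R, Real.pi ^ 2 / 8 * ((b n).re - (b n).im),
    fun k => if k.2 then Real.pi ^ 2 / 4 * (b k.1).im else -(Real.pi ^ 2 / 4) * (b k.1).re, ?_⟩
  have hG : ∀ x : Fin d → ℝ, (a₀.re + ∑ n ∈ freqBall d R, Real.pi ^ 2 / 8 * ((b n).re - (b n).im)) +
      ∑ k : (freqBall d R) × Bool,
        (if k.2 then Real.pi ^ 2 / 4 * (b k.1).im else -(Real.pi ^ 2 / 4) * (b k.1).re) *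
          triWave (∑ i, (k.1.1 i : ℝ) * x i + wavePhase k.2) =
      (a₀ * fourierExp 0 x + ∑ n ∈ freqBall d R, b n * triRidge n x).re := by
    intro x
    rw [Fintype.sum_prod_type, Complex.add_re, Complex.re_sum, fourierExp_zero, mul_one, add_assoc,
      ← Finset.sum_coe_sort (freqBall d R), ← Finset.sum_coe_sort (freqBall d R),
      ← Finset.sum_add_distrib]
    congr 1
    refine Finset.sum_congr rfl fun n _ => ?_
    rw [triRidge, re_mul_complexTriWave]
    simp [wavePhase]
    ring
  simp only [hG]
  have hmono : eLpNorm (fun x => f x -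
      (a₀ * fourierExp 0 x + ∑ n ∈ freqBall d R, b n * triRidge n x).re) 2 (cubeMeasure d) ≤
      eLpNorm (fun x => (f x : ℂ) -
        (a₀ * fourierExp 0 x + ∑ n ∈ freqBall d R, b n * triRidge n x)) 2 (cubeMeasure d) := by
    refine eLpNorm_mono fun x => ?_
    rw [← Complex.ofReal_re (f x), ← Complex.sub_re, Real.norm_eq_abs]
    exact Complex.abs_re_le_norm _
  refine hmono.trans ?_
  have hae : (fun x => (f x : ℂ) -
        (a₀ * fourierExp 0 x + ∑ n ∈ freqBall d R, b n * triRidge n x)) =ᵐ[cubeMeasure d]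
      ((hfC.toLp - (a₀ • expLp 0 + ∑ n ∈ freqBall d R, b n • (memLp_triRidge n).toLp) :
        Lp ℂ 2 (cubeMeasure d)) : (Fin d → ℝ) → ℂ) := by
    filter_upwards [Lp.coeFn_sub hfC.toLp
        (a₀ • expLp 0 + ∑ n ∈ freqBall d R, b n • (memLp_triRidge n).toLp),
      Lp.coeFn_add (a₀ • expLp 0) (∑ n ∈ freqBall d R, b n • (memLp_triRidge n).toLp),
      Lp.coeFn_smul a₀ (expLp (d := d) 0), (memLp_fourierExp (0 : Fin d → ℤ)).coeFn_toLp,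
      hfC.coeFn_toLp, coeFn_sum_smul_toLp memLp_triRidge b (freqBall d R)]
      with x h1 h2 h3 h4 h5 h6
    rw [h1, Pi.sub_apply, h2, Pi.add_apply, h3, Pi.smul_apply, expLp, h4, h5, h6, smul_eq_mul]
  rw [eLpNorm_congr_ae hae, ← Lp.enorm_def, ← ofReal_norm]
  exact ENNReal.ofReal_le_ofReal hb

lemma abs_sum_mul_le_of_mem_freqBall {d : ℕ} {R : ℝ} {n : Fin d → ℤ} (hn : n ∈ freqBall d R)
    {x : Fin d → ℝ} (hx : x ∈ Set.Icc 0 1) : |∑ i, (n i : ℝ) * x i| ≤ ⌈R ^ 2⌉₊ := by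
  have h : |∑ i, (n i : ℝ) * x i| ≤ ((∑ i, (n i).natAbs : ℕ) : ℝ) := by
    refine (Finset.abs_sum_le_sum_abs _ _).trans ?_
    push_cast
    refine Finset.sum_le_sum fun i _ => ?_
    rw [abs_mul, Nat.cast_natAbs, Int.cast_abs, abs_of_nonneg (hx.1 i)]
    exact mul_le_of_le_one_right (abs_nonneg _) (hx.2 i)
  refine (h.trans (sum_natAbs_le_freqNorm_sq n)).trans ?_
  exact (pow_le_pow_left₀ (freqNorm_nonneg n) (mem_freqBall.mp hn) 2).trans (Nat.le_ceil _)

/-- The affine function `x ↦ n · x + θ`. -/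
def ridgeMap {d : ℕ} (n : Fin d → ℤ) (θ : ℝ) : (Fin d → ℝ) →ᵃ[ℝ] ℝ := weightedSum θ fun i => n i

lemma ridgeMap_apply {d : ℕ} (n : Fin d → ℤ) (θ : ℝ) (x : Fin d → ℝ) :
    ridgeMap n θ x = θ + ∑ i, (n i : ℝ) * x i := weightedSum_apply _ _ _

/-- The integer shift leaves the wave unchanged and makes its argument nonnegative, as both network
constructions require. -/
lemma ridgeMap_mem_Icc {d : ℕ} {R : ℝ} {n : Fin d → ℤ} (hn : n ∈ freqBall d R) (b : Bool)
    {x : Fin d → ℝ} (hx : x ∈ Set.Icc 0 1) :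
    ridgeMap n (wavePhase b + ⌈R ^ 2⌉₊) x ∈ Set.Icc (0 : ℝ) (2 * ⌈R ^ 2⌉₊ + 1) := by
  have h := abs_le.mp (abs_sum_mul_le_of_mem_freqBall hn hx)
  have hb0 : 0 ≤ wavePhase b := by unfold wavePhase; split_ifs <;> norm_num
  have hb1 : wavePhase b ≤ 1 := by unfold wavePhase; split_ifs <;> norm_num
  rw [ridgeMap_apply]
  constructor <;> linarith [h.1, h.2]

lemma triWave_ridgeMap {d : ℕ} (n : Fin d → ℤ) (θ : ℝ) (M : ℕ) (x : Fin d → ℝ) :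
    triWave (ridgeMap n (θ + M) x) = triWave (∑ i, (n i : ℝ) * x i + θ) := by
  rw [← triWave_add_int (∑ i, (n i : ℝ) * x i + θ) M, ridgeMap_apply]
  congr 1
  push_cast
  ring

lemma iInf_eLpNorm_le_of_eval_eq {d W L : ℕ} {f g : (Fin d → ℝ) → ℝ} (N : ReLUNetwork d W L)
    (hN : ∀ x ∈ Set.Icc (0 : Fin d → ℝ) 1, N.eval x = g x) :
    ⨅ N : ReLUNetwork d W L, eLpNorm (fun x => f x - N.eval x) 2 (cubeMeasure d) ≤
      eLpNorm (fun x => f x - g x) 2 (cubeMeasure d) := by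
  refine (iInf_le _ N).trans (le_of_eq (eLpNorm_congr_ae ?_))
  filter_upwards [ae_restrict_mem measurableSet_Icc] with x hx
  rw [hN x hx]

theorem iInf_eLpNorm_le_of_deep {d W L r : ℕ} {s : ℝ} (hs0 : 0 < s) (hs1 : s < 1)
    {f : (Fin d → ℝ) → ℝ} (hf : MemSobolev s f) {R : ℝ} (hR : 0 < R)
    (hW : 4 * (freqBall d R).card ≤ W) (hr : 2 * ⌈R ^ 2⌉₊ + 1 ≤ 2 ^ r) (hL : r + 1 ≤ L) :
    ⨅ N : ReLUNetwork d W L, eLpNorm (fun x => f x - N.eval x) 2 (cubeMeasure d) ≤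
      ENNReal.ofReal (approxConst s * R ^ (-s) * sobolevNorm s f) := by
  obtain ⟨c, v, hcv⟩ := exists_real_triangle_sum_approx hs0 hs1 hf hR
  have hr' : (2 * ⌈R ^ 2⌉₊ + 1 : ℝ) ≤ 2 ^ r := by exact_mod_cast hr
  obtain ⟨N, hN⟩ := exists_reluNetwork_deep (κ := (freqBall d R) × Bool) (d := d) (W := W)
    (by rw [Fintype.card_prod, Fintype.card_bool, Fintype.card_coe]; lia) hL
    (fun k => ((2 : ℝ) ^ r)⁻¹ • ridgeMap k.1.1 (wavePhase k.2 + ⌈R ^ 2⌉₊)) v c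
  refine (iInf_eLpNorm_le_of_eval_eq N fun x hx => ?_).trans hcv
  rw [hN x fun k => ?_]
  · congr 1
    refine Finset.sum_congr rfl fun k _ => ?_
    rw [AffineMap.coe_smul, Pi.smul_apply, smul_eq_mul, mul_inv_cancel_left₀ (by positivity), triWave_ridgeMap]
  · have h := ridgeMap_mem_Icc k.1.2 k.2 hx
    rw [AffineMap.coe_smul, Pi.smul_apply, smul_eq_mul]
    refine ⟨mul_nonneg (by positivity) h.1, ?_⟩
    rw [inv_mul_le_iff₀ (by positivity), mul_one]
    exact h.2.trans hr'

theorem iInf_eLpNorm_le_of_shallow {d W L : ℕ} {s : ℝ} (hs0 : 0 < s) (hs1 : s < 1)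
    {f : (Fin d → ℝ) → ℝ} (hf : MemSobolev s f) {R : ℝ} (hR : 0 < R)
    (hW : (freqBall d R).card * 2 * (4 * ⌈R ^ 2⌉₊ + 2) ≤ W) :
    ⨅ N : ReLUNetwork d W L, eLpNorm (fun x => f x - N.eval x) 2 (cubeMeasure d) ≤
      ENNReal.ofReal (approxConst s * R ^ (-s) * sobolevNorm s f) := by
  obtain ⟨c, v, hcv⟩ := exists_real_triangle_sum_approx hs0 hs1 hf hR
  obtain ⟨N, hN⟩ := exists_reluNetwork_shallow (κ := (freqBall d R) × Bool) (d := d) (W := W)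
    (L := L) (n := 4 * ⌈R ^ 2⌉₊ + 1)
    (by rw [Fintype.card_prod, Fintype.card_bool, Fintype.card_coe]; exact hW)
    (fun k => ridgeMap k.1.1 (wavePhase k.2 + ⌈R ^ 2⌉₊)) v c
  refine (iInf_eLpNorm_le_of_eval_eq N fun x hx => ?_).trans hcv
  rw [hN x fun k => ?_]
  · congr 1
    exact Finset.sum_congr rfl fun k _ => by rw [triWave_ridgeMap]
  · have h := ridgeMap_mem_Icc k.1.2 k.2 hx
    refine ⟨h.1, h.2.trans (le_of_eq ?_)⟩
    push_cast
    ring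

/-! ### Width and depth estimates -/

/-- Two phases with two neurons each give the factor `4 ≤ 4 ^ d`, whence `36 = 4 * 9`. -/
lemma four_mul_card_freqBall_le {d : ℕ} (hd : 0 < d) {a ρ : ℝ} (ha : 1 ≤ a)
    (hρ : Real.sqrt d ≤ ρ) :
    4 * ((freqBall d (a * ρ)).card : ℝ) ≤ (36 * a * ρ / Real.sqrt d) ^ d := by
  have hd' : 0 < Real.sqrt d := Real.sqrt_pos.mpr (by exact_mod_cast hd)
  have hρ0 : 0 < ρ := hd'.trans_le hρ
  have h := card_freqBall_le_pow hd (R := a * ρ) (hρ.trans (le_mul_of_one_le_left hρ0.le ha))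
  have h4 : (4 : ℝ) ≤ 4 ^ d := le_self_pow₀ (by norm_num) hd.ne'
  calc 4 * ((freqBall d (a * ρ)).card : ℝ) ≤ 4 ^ d * (9 * (a * ρ / Real.sqrt d)) ^ d := by gcongr
    _ = (36 * a * ρ / Real.sqrt d) ^ d := by
        rw [← mul_pow]
        congr 1
        ring

/-- With `R = a * ρ ≥ 1`, `2 * ⌈R²⌉ + 1 ≤ 5 * R²`, so `r = ⌈log₂ (5 * R²)⌉` works. Then `r + 1 ≤ 5 +
2 * log₂ a + (2 / s) * ℓ`, and `ℓ ≥ 1` absorbs the constants. -/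
lemma exists_depth {a ρ ℓ s : ℝ} (ha : 1 ≤ a) (hρ : 1 ≤ ρ) (hℓ : 1 ≤ ℓ)
    (hρℓ : Real.logb 2 ρ = 1 / s * ℓ) {L : ℕ}
    (hL : (5 + 2 * Real.logb 2 a + 2 / s) * ℓ ≤ L) :
    ∃ r : ℕ, 2 * ⌈(a * ρ) ^ 2⌉₊ + 1 ≤ 2 ^ r ∧ r + 1 ≤ L := by
  have hR : 1 ≤ a * ρ := one_le_mul_of_one_le_of_one_le ha hρ
  have hR2 : 1 ≤ (a * ρ) ^ 2 := one_le_pow₀ hR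
  have ha0 : 0 < a := by linarith
  have hρ0 : 0 < ρ := by linarith
  have h5pos : 0 < 5 * (a * ρ) ^ 2 := by positivity
  refine ⟨⌈Real.logb 2 (5 * (a * ρ) ^ 2)⌉₊, ?_, ?_⟩
  · have h1 : 5 * (a * ρ) ^ 2 ≤ 2 ^ ⌈Real.logb 2 (5 * (a * ρ) ^ 2)⌉₊ := by
      rw [← Real.rpow_natCast 2, ← Real.logb_le_iff_le_rpow (by norm_num) h5pos]
      exact Nat.le_ceil _
    have h2 := (Nat.ceil_lt_add_one (a := (a * ρ) ^ 2) (by positivity)).le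
    have h3 : (2 * ⌈(a * ρ) ^ 2⌉₊ + 1 : ℝ) ≤ 2 ^ ⌈Real.logb 2 (5 * (a * ρ) ^ 2)⌉₊ := by linarith
    exact_mod_cast h3
  · have hnn : 0 ≤ Real.logb 2 (5 * (a * ρ) ^ 2) :=
      Real.logb_nonneg (by norm_num) (by linarith)
    have h1 := (Nat.ceil_lt_add_one hnn).le
    have h2 : Real.logb 2 (5 * (a * ρ) ^ 2) =
        Real.logb 2 5 + 2 * (Real.logb 2 a + Real.logb 2 ρ) := by
      rw [Real.logb_mul (by norm_num) (by positivity), Real.logb_pow,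
        Real.logb_mul ha0.ne' hρ0.ne']
      push_cast
      ring
    have h3 : Real.logb 2 5 ≤ 3 := by
      rw [Real.logb_le_iff_le_rpow (by norm_num) (by norm_num)]
      norm_num
    have h4 : 0 ≤ Real.logb 2 a := Real.logb_nonneg (by norm_num) ha
    have h5 : (5 + 2 * Real.logb 2 a) * 1 ≤ (5 + 2 * Real.logb 2 a) * ℓ :=
      mul_le_mul_of_nonneg_left hℓ (by linarith)
    have h6 : ((⌈Real.logb 2 (5 * (a * ρ) ^ 2)⌉₊ + 1 : ℕ) : ℝ) ≤ L := by
      push_cast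
      have h7 : 2 * (1 / s * ℓ) = 2 / s * ℓ := by ring
      rw [hρℓ] at h2
      linarith
    exact_mod_cast h6

lemma exp_le_rpow {X y : ℝ} (hX : Real.exp 1 ≤ X) (hy : 0 ≤ y) : Real.exp y ≤ X ^ y := by
  rw [← Real.exp_one_rpow]
  exact Real.rpow_le_rpow (Real.exp_pos 1).le hX hy

/-- Let `X` be the base on the right; it is at least `e`. Counting with `1 / q = 2 * γ² * d / ρ² ≤
X` costs `X ^ (a² * ρ²)` for the power of `1 / q` and `X ^ (2 * ρ²)` for the exponential. The
neurons per frequency number at most `20 * (a * ρ)² ≤ X ^ (4 * ρ²) * X ^ (a² * ρ²)`. The exponents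
add up to `(2 * a² + 6) * ρ²`. -/
lemma shallow_width_le {d : ℕ} {a ρ γ c : ℝ} (ha : 1 ≤ a) (hρ : 1 ≤ ρ) (hγ : 1 ≤ γ)
    (hρd : ρ ^ 2 ≤ γ ^ 2 * d) (hc : 3 * γ ^ 2 ≤ c) :
    ((freqBall d (a * ρ)).card : ℝ) * 2 * (4 * ⌈(a * ρ) ^ 2⌉₊ + 2) ≤
      (c * (ρ ^ 2)⁻¹ * d) ^ ((2 * a ^ 2 + 6) * ρ ^ 2) := by
  have hρ0 : 0 < ρ := by linarith
  have hρ2 : 1 ≤ ρ ^ 2 := one_le_pow₀ hρ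
  have hγ2 : 1 ≤ γ ^ 2 := one_le_pow₀ hγ
  have hγd : 0 < γ ^ 2 * d := by linarith
  have hd : (0 : ℝ) < d := pos_of_mul_pos_right hγd (by positivity)
  set Z : ℝ := (ρ ^ 2)⁻¹ * d with hZ
  have hZ0 : 0 < Z := by positivity
  have hγZ : 1 ≤ γ ^ 2 * Z := by
    rw [hZ, mul_left_comm, ← div_eq_inv_mul, one_le_div (by positivity)]
    exact hρd
  rw [mul_assoc c, ← hZ]
  set X := c * Z with hX
  have hX3 : 3 * (γ ^ 2 * Z) ≤ X := by
    rw [hX, ← mul_assoc]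
    exact mul_le_mul_of_nonneg_right hc hZ0.le
  have hXe : Real.exp 1 ≤ X := by linarith [Real.exp_one_lt_d9]
  have hX0 : 0 < X := (Real.exp_pos 1).trans_le hXe
  set q := (2 * (γ ^ 2 * Z))⁻¹ with hq
  have hq0 : 0 < q := by positivity
  have hq1 : q ≤ 1 / 2 := by
    rw [hq, one_div]
    exact inv_anti₀ (by norm_num) (by linarith)
  have hcard := card_freqBall_le_rpow (d := d) (R := a * ρ) hq0 hq1
  have hqd : 4 * q * d ≤ 2 * ρ ^ 2 := by
    have : 4 * q * d = 2 * ρ ^ 2 * (γ ^ 2)⁻¹ := by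
      rw [hq, hZ]
      field_simp
      ring
    rw [this]
    exact mul_le_of_le_one_right (by positivity) (inv_le_one_of_one_le₀ hγ2)
  have hR2 : 1 ≤ (a * ρ) ^ 2 := one_le_pow₀ (one_le_mul_of_one_le_of_one_le ha hρ)
  have h1 : (1 / q) ^ ((a * ρ) ^ 2) ≤ X ^ ((a * ρ) ^ 2) := by
    refine Real.rpow_le_rpow (by positivity) ?_ (by positivity)
    rw [hq, one_div, inv_inv]
    linarith
  have h2 : Real.exp (4 * q * d) ≤ X ^ (2 * ρ ^ 2) :=
    (Real.exp_le_exp.mpr hqd).trans (exp_le_rpow hXe (by positivity))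
  have h3 : 2 * (4 * (⌈(a * ρ) ^ 2⌉₊ : ℝ) + 2) ≤ X ^ (4 * ρ ^ 2) * X ^ ((a * ρ) ^ 2) := by
    have h4 := (Nat.ceil_lt_add_one (a := (a * ρ) ^ 2) (by positivity)).le
    have h5 : (20 : ℝ) ≤ X ^ (4 * ρ ^ 2) := by
      have h6 : (20 : ℝ) ≤ Real.exp 4 := by
        have : Real.exp 4 = Real.exp 1 ^ 4 := by rw [← Real.exp_nat_mul]; norm_num
        rw [this]
        have h7 : (2.7 : ℝ) ≤ Real.exp 1 := by linarith [Real.exp_one_gt_d9]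
        calc (20 : ℝ) ≤ 2.7 ^ 4 := by norm_num
          _ ≤ _ := pow_le_pow_left₀ (by norm_num) h7 4
      refine h6.trans ((Real.exp_le_exp.mpr (by linarith)).trans (exp_le_rpow hXe (by positivity)))
    have h8 : (a * ρ) ^ 2 ≤ X ^ ((a * ρ) ^ 2) := by
      refine le_trans ?_ (exp_le_rpow hXe (by positivity))
      linarith [Real.add_one_le_exp ((a * ρ) ^ 2)]
    calc _ ≤ 20 * (a * ρ) ^ 2 := by linarith
      _ ≤ _ := mul_le_mul h5 h8 (by positivity) (by positivity)
  calc ((freqBall d (a * ρ)).card : ℝ) * 2 * (4 * ⌈(a * ρ) ^ 2⌉₊ + 2)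
      = ((freqBall d (a * ρ)).card : ℝ) * (2 * (4 * ⌈(a * ρ) ^ 2⌉₊ + 2)) := by ring
    _ ≤ (X ^ ((a * ρ) ^ 2) * X ^ (2 * ρ ^ 2)) * (X ^ (4 * ρ ^ 2) * X ^ ((a * ρ) ^ 2)) := by
        refine mul_le_mul (hcard.trans ?_) h3 (by positivity) (by positivity)
        exact mul_le_mul h1 h2 (Real.exp_pos _).le (by positivity)
    _ = X ^ ((2 * a ^ 2 + 6) * ρ ^ 2) := by
        rw [← Real.rpow_add hX0, ← Real.rpow_add hX0, ← Real.rpow_add hX0]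
        congr 1
        ring

end

theorem mainTheorem8 (s : ℝ) (hs0 : 0 < s) (hs1 : s < 1) :
    ∃ c₃ c₄ c₅ : ℝ, 0 < c₃ ∧ 0 < c₄ ∧ 0 < c₅ ∧
      ∀ (d : ℕ), 0 < d → ∀ ε : ℝ, 0 < ε → ε < 1 →
      ∀ (W L : ℕ), 0 < W → 0 < L →
        ((c₃ * (d : ℝ) ^ (-s / 2) ≤ ε ∧
            (c₄ * ε ^ (2 / s) * (d : ℝ)) ^ (c₅ * ε ^ (-(2 / s))) ≤ (W : ℝ) ∧
            c₄ * Real.logb 2 (1 / ε) ≤ (L : ℝ)) ∨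
          (ε ≤ c₃ * (d : ℝ) ^ (-s / 2) ∧
            (c₄ / (ε ^ (1 / s) * Real.sqrt (d : ℝ))) ^ d ≤ (W : ℝ) ∧
            c₄ * Real.logb 2 (1 / ε) ≤ (L : ℝ))) →
        ∀ f : (Fin d → ℝ) → ℝ, MemSobolev s f →
          (⨅ N : ReLUNetwork d W L, eLpNorm (fun x => f x - N.eval x) 2 (cubeMeasure d)) ≤
            ENNReal.ofReal (ε * sobolevNorm s f) := by
  -- The radius will be `a * ρ` with `ρ = ε ^ (-(1 / s))`; this `a` makes the error factor exactly
  -- `ε`.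
  set a : ℝ := approxConst s ^ (1 / s) with ha_def
  set γ : ℝ := 2 ^ (1 / s) with hγ_def
  have hD := one_le_approxConst s
  have ha : 1 ≤ a := Real.one_le_rpow hD (by positivity)
  have hγ : 1 ≤ γ := Real.one_le_rpow (by norm_num) (by positivity)
  have hla : 0 ≤ Real.logb 2 a := Real.logb_nonneg (by norm_num) ha
  have hdepth : 0 < 5 + 2 * Real.logb 2 a + 2 / s := by positivity
  -- The value `c₃ = 1 / 2` puts the threshold at `ρ = γ * √d` and forces `log₂ (1 / ε) ≥ 1` in the
  -- second regime. The summands of `c₄` serve the width of the deep network, its depth, and the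
  -- width of the shallow network.
  refine ⟨1 / 2, 36 * a + (5 + 2 * Real.logb 2 a + 2 / s) + 3 * γ ^ 2, 2 * a ^ 2 + 6, by norm_num,
    by positivity, by positivity, ?_⟩
  intro d hd ε hε0 hε1 W L _ _ hWL f hf
  have hd0 : (0 : ℝ) < d := by exact_mod_cast hd
  have hd1 : (1 : ℝ) ≤ d := by exact_mod_cast hd
  set ρ : ℝ := ε ^ (-(1 / s)) with hρ_def
  have hρ1 : 1 ≤ ρ := Real.one_le_rpow_of_pos_of_le_one_of_nonpos hε0 hε1.le
    (neg_nonpos.mpr (by positivity))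
  have hρ0 : 0 < ρ := by linarith
  have hερ : ε ^ (1 / s) = ρ⁻¹ := by rw [hρ_def, Real.rpow_neg hε0.le, inv_inv]
  have hρ2 : ε ^ (-(2 / s)) = ρ ^ 2 := by
    rw [hρ_def, ← Real.rpow_mul_natCast hε0.le]
    congr 1
    push_cast
    ring
  have hερ2 : ε ^ (2 / s) = (ρ ^ 2)⁻¹ := by rw [← hρ2, Real.rpow_neg hε0.le, inv_inv]
  have hR : 0 < a * ρ := by positivity
  have herr : approxConst s * (a * ρ) ^ (-s) = ε := by
    have h1 : a ^ (-s) = (approxConst s)⁻¹ := by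
      rw [ha_def, ← Real.rpow_mul (by linarith), ← Real.rpow_neg_one]
      congr 1
      field_simp
    have h2 : ρ ^ (-s) = ε := by
      rw [hρ_def, ← Real.rpow_mul hε0.le]
      convert Real.rpow_one ε using 2
      field_simp
    rw [Real.mul_rpow (by linarith) hρ0.le, h1, h2, mul_inv_cancel_left₀ (by linarith)]
  have hthreshold : (1 / 2 * (d : ℝ) ^ (-s / 2)) ^ (-(1 / s)) = γ * Real.sqrt d := by
    rw [Real.mul_rpow (by norm_num) (by positivity), ← Real.rpow_mul hd0.le, Real.sqrt_eq_rpow,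
      one_div, Real.inv_rpow (by norm_num), Real.rpow_neg (by norm_num), inv_inv, hγ_def, one_div]
    congr 2
    field_simp
  rw [← herr]
  rcases hWL with ⟨hε, hW, -⟩ | ⟨hε, hW, hL⟩
  · refine iInf_eLpNorm_le_of_shallow hs0 hs1 hf hR ?_
    have hρd : ρ ≤ γ * Real.sqrt d := by
      rw [← hthreshold, hρ_def]
      exact Real.rpow_le_rpow_of_nonpos (by positivity) hε (neg_nonpos.mpr (by positivity))
    have hρd2 : ρ ^ 2 ≤ γ ^ 2 * d := by
      have := pow_le_pow_left₀ hρ0.le hρd 2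
      rwa [mul_pow, Real.sq_sqrt hd0.le] at this
    rw [hρ2, hερ2] at hW
    have h := (shallow_width_le ha hρ1 hγ hρd2
      (c := 36 * a + (5 + 2 * Real.logb 2 a + 2 / s) + 3 * γ ^ 2) (by linarith)).trans hW
    exact_mod_cast h
  · have hρd : γ * Real.sqrt d ≤ ρ := by
      rw [← hthreshold, hρ_def]
      exact Real.rpow_le_rpow_of_nonpos hε0 hε (neg_nonpos.mpr (by positivity))
    have hℓ : 1 ≤ Real.logb 2 (1 / ε) := by
      have h1 : (d : ℝ) ^ (-s / 2) ≤ 1 :=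
        Real.rpow_le_one_of_one_le_of_nonpos hd1 (by linarith)
      rw [Real.le_logb_iff_rpow_le (by norm_num) (by positivity), Real.rpow_one,
        le_div_iff₀ hε0]
      linarith
    have hρℓ : Real.logb 2 ρ = 1 / s * Real.logb 2 (1 / ε) := by
      rw [hρ_def, Real.logb_rpow_eq_mul_logb_of_pos hε0, one_div ε, Real.logb_inv]
      ring
    obtain ⟨r, hr, hrL⟩ := exists_depth ha hρ1 hℓ hρℓ (L := L) (by
      refine le_trans (mul_le_mul_of_nonneg_right ?_ (by linarith)) hL
      have : 0 ≤ γ ^ 2 := sq_nonneg γ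
      linarith)
    refine iInf_eLpNorm_le_of_deep hs0 hs1 hf hR ?_ hr hrL
    have hsd : 0 < Real.sqrt d := Real.sqrt_pos.mpr hd0
    have h := four_mul_card_freqBall_le hd ha
      ((le_mul_of_one_le_left hsd.le hγ).trans hρd)
    have h2 : (36 * a * ρ / Real.sqrt d) ^ d ≤ (W : ℝ) := by
      refine le_trans (pow_le_pow_left₀ (by positivity) ?_ d) hW
      rw [hερ, ← div_div, div_inv_eq_mul]
      have : 0 ≤ γ ^ 2 := sq_nonneg γ
      gcongr
      linarith
    have h3 := h.trans h2
    exact_mod_cast h3
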